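/- Let $K$ be a field and let $E=(E^0,E^1,s,r)$ be an arbitrary directed graph. Let $L_K(E)$ be its Leavitt path algebra: the (not necessarily unital) associative $K$-algebra generated by the vertices $v$, the edges $f$ and the ghost edges $f^*$, subject to the relations of the path algebra of the double graph, to $f^*f'=\delta_{f,f'}r(f)$, and to $v=\sum_{s(f)=v}ff^*$ for every vertex $v$ that emits a non-zero finite number of edges. Modules are unital left $L_K(E)$-modules ($L_K(E)M=M$), and $\operatorname{Ext}^1$ is taken in the category of these modules. A cycle is a closed path $c=c_1\cdots c_n$ ($n\ge 1$) with $s(c_i)\ne s(c_j)$ for $i\neq j$; put $s(c)=s(c_1)$ and $c^\infty=ccc\cdots$. A cycle is exclusive if it has no vertex in common with any cycle that is not a cyclic permutation of it. Let $[c^\infty]$ be the set of infinite paths that are tail equivalent to $c^\infty$. A polynomial $p\in K[x]$ is basic irreducible if it is irreducible and $p(0)=-1$. For such a $p$ put $K'=K[x]/(p)$ and let $\overline x\in K'$ be the class of $x$. The module $V^p_{[c^\infty]}$ is the $K'$-vector space with basis $[c^\infty]$, on which $L_{K'}(E)$ acts by concatenation and deletion of first edges, twisted by the automorphism $c_1\mapsto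 \overline x c_1$, $c_1^*\mapsto \overline x^{-1}c_1^*$ of $L_{K'}(E)$ that fixes all other vertices, edges and ghost edges, and regarded as an $L_K(E)$-module by restriction of scalars. Let $c$ and $e$ be exclusive cycles in $E$, let $p,q\in K[x]$ be basic irreducible polynomials, and let $L_{c,e}$ be the set of the infinite paths $\lambda\in[e^\infty]$ that start at $s(c)$ and do not have $c$ as an initial segment. Then $$\dim_K \operatorname{Ext}^1(V^p_{[c^\infty]},V^q_{[e^\infty]})=\begin{cases}|L_{c,e}|\cdot\deg p\cdot\deg q & \text{if } c \text{ and } e \text{ are not cyclic permutations of each other},\\ 0 & \text{if } c \text{ is a cyclic permutation of } e \text{ (for instance } c=e\text{) and } p\neq q,\\ \deg p & \text{if } c \text{ is a cyclic permutation of } e \text{ (for instance } c=e\text{) and } p=q.\end{cases}$$ Dimensions and cardinalities may be infinite; the equalities are equalities of cardinal numbers. -/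

import Mathlib

open Polynomial CategoryTheory

universe u v w

noncomputable section

/-- A directed graph: vertices, edges, source and range; no finiteness or countability is assumed,
and parallel edges and loops are allowed. -/
structure DirectedGraph where
  Vertex : Type u
  Edge : Type u
  s : Edge → Vertex
  r : Edge → Vertex

namespace DirectedGraph

variable (E : DirectedGraph.{u})

/-! ### Cycles and infinite paths -/

/-- A cycle `e₁ e₂ ⋯ eₙ` (`n ≥ 1`): a path with `r(eₙ) = s(e₁)` whose edges have pairwise distinct
sources. Cycles are based: a cyclic permutation of `edges` is another term of this type. -/
structure Cycle where
  edges : List E.Edge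
  ne_nil : edges ≠ []
  isChain : edges.IsChain (fun a b => E.r a = E.s b)
  closed : E.r (edges.getLast ne_nil) = E.s (edges.head ne_nil)
  nodup : (edges.map E.s).Nodup

/-- An infinite path: a sequence of edges `f₀ f₁ f₂ ⋯` with `r(fₙ) = s(fₙ₊₁)`. -/
@[ext] structure InfPath where
  edge : ℕ → E.Edge
  chain : ∀ n, E.r (edge n) = E.s (edge (n + 1))

variable {E}

namespace InfPath

/-- The source of an infinite path. -/
def source (x : E.InfPath) : E.Vertex := E.s (x.edge 0)

/-- The infinite path obtained by deleting the first edge. -/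
def tail (x : E.InfPath) : E.InfPath where
  edge n := x.edge (n + 1)
  chain n := x.chain (n + 1)

/-- The infinite path `f x`, for an edge `f` with `r(f) = s(x)`. -/
def cons (f : E.Edge) (x : E.InfPath) (h : E.r f = x.source) : E.InfPath where
  edge n := n.casesOn f x.edge
  chain n := by
    cases n with
    | zero => exact h
    | succ n => exact x.chain n

/-- Two infinite paths are tail equivalent if they are `λ z` and `μ z` for finite paths `λ`, `μ`
and one infinite path `z`. -/
def TailEquiv (x y : E.InfPath) : Prop := ∃ m n : ℕ, ∀ k, x.edge (m + k) = y.edge (n + k)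

theorem tailEquiv_tail {x y : E.InfPath} (h : x.TailEquiv y) : x.tail.TailEquiv y := by
  obtain ⟨m, n, h⟩ := h
  refine ⟨m, n + 1, fun k => ?_⟩
  have := h (k + 1)
  simp only [tail]
  rw [add_assoc, this]
  congr 1
  ring

theorem tailEquiv_cons {x y : E.InfPath} (h : x.TailEquiv y) (f : E.Edge)
    (hf : E.r f = x.source) : (cons f x hf).TailEquiv y := by
  obtain ⟨m, n, h⟩ := h
  refine ⟨m + 1, n, fun k => ?_⟩
  rw [← h k, show m + 1 + k = (m + k) + 1 by ring]
  rfl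

end InfPath

namespace Cycle

theorem length_pos (c : E.Cycle) : 0 < c.edges.length := List.length_pos_of_ne_nil c.ne_nil

/-- The first edge of a cycle. -/
def first (c : E.Cycle) : E.Edge := c.edges.head c.ne_nil

/-- The source of a cycle, that is, the vertex at which it is based. -/
def source (c : E.Cycle) : E.Vertex := E.s c.first

/-- The infinite path `c c c ⋯`. -/
def infty (c : E.Cycle) : E.InfPath where
  edge n := c.edges[n % c.edges.length]'(Nat.mod_lt _ c.length_pos)
  chain n := by
    have hpos := c.length_pos
    have hlt : n % c.edges.length < c.edges.length := Nat.mod_lt _ hpos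
    by_cases h : n % c.edges.length + 1 < c.edges.length
    · have h1 : (n + 1) % c.edges.length = n % c.edges.length + 1 := by
        rw [Nat.add_mod, Nat.mod_eq_of_lt (show 1 < c.edges.length by omega), Nat.mod_eq_of_lt h]
      simp only [h1]
      exact List.isChain_iff_getElem.mp c.isChain _ h
    · have h2 : n % c.edges.length = c.edges.length - 1 := by omega
      have h1 : (n + 1) % c.edges.length = 0 := by
        have hdvd : c.edges.length ∣ n + 1 := by
          refine ⟨n / c.edges.length + 1, ?_⟩
          have := Nat.div_add_mod n c.edges.length
          rw [mul_add]
          omega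
        exact Nat.mod_eq_zero_of_dvd hdvd
      simp only [h1, h2]
      have hc := c.closed
      rw [List.getLast_eq_getElem, List.head_eq_getElem] at hc
      exact hc

/-- `c` and `d` are cyclic permutations of each other. -/
def IsRotation (c d : E.Cycle) : Prop := c.edges ~r d.edges

/-- A cycle is exclusive if it has no vertex in common with any other cycle, where the cyclic
permutations of a cycle do not count as other cycles. -/
def IsExclusive (c : E.Cycle) : Prop :=
  ∀ d : E.Cycle, ¬ c.IsRotation d → ∀ x ∈ c.edges, ∀ y ∈ d.edges, E.s x ≠ E.s y

/-- The infinite path `x` starts by going once through the cycle `c`. -/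
def Divides (c : E.Cycle) (x : E.InfPath) : Prop :=
  ∀ (i : ℕ) (h : i < c.edges.length), x.edge i = c.edges[i]

/-- The set `[c^∞]` of the infinite paths that are tail equivalent to `c^∞`. -/
abbrev TailClass (c : E.Cycle) : Type u := {x : E.InfPath // x.TailEquiv c.infty}

end Cycle

/-- `L_{c,e}`: the infinite paths that are tail equivalent to `e^∞`, start at the source of `c`,
and do not start by going through `c`. -/
def pathsBetween (c e : E.Cycle) : Set E.InfPath :=
  {x | x.TailEquiv e.infty ∧ ¬ c.Divides x ∧ x.source = c.source}

/-! ### Leavitt path algebras -/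

variable (E)

/-- The generators: vertices `v`, edges `f` and ghost edges `f*`. -/
inductive Gen : Type u
  | vertex (v : E.Vertex) : Gen
  | edge (f : E.Edge) : Gen
  | ghost (f : E.Edge) : Gen

/-- The free associative (non-unital) `R`-algebra on the generators. -/
abbrev FreeAlg (R : Type v) [CommRing R] : Type (max u v) := MonoidAlgebra R (FreeSemigroup E.Gen)

/-- The generators in the free algebra. -/
def FreeAlg.of (R : Type v) [CommRing R] (g : E.Gen) : FreeAlg E R :=
  MonoidAlgebra.single (FreeSemigroup.of g) 1

open Classical in
/-- The relations of a Leavitt path algebra, for a family of elements of a ring that is indexed by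
the generators. The first six express that products are those of the path algebra of the double
graph (an edge `f` goes from `s(f)` to `r(f)`, its ghost `f*` from `r(f)` to `s(f)`);
the others are the Cuntz-Krieger relations. -/
structure IsLeavittFamily {A : Type w} [NonUnitalRing A] (a : E.Gen → A) : Prop where
  vertex_mul_vertex : ∀ v v', a (.vertex v) * a (.vertex v') = if v = v' then a (.vertex v) else 0
  source_mul_edge : ∀ f, a (.vertex (E.s f)) * a (.edge f) = a (.edge f)
  edge_mul_range : ∀ f, a (.edge f) * a (.vertex (E.r f)) = a (.edge f)
  range_mul_ghost : ∀ f, a (.vertex (E.r f)) * a (.ghost f) = a (.ghost f)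
  ghost_mul_source : ∀ f, a (.ghost f) * a (.vertex (E.s f)) = a (.ghost f)
  ghost_mul_edge : ∀ f f', a (.ghost f) * a (.edge f') = if f = f' then a (.vertex (E.r f)) else 0
  sum_edge_mul_ghost : ∀ (v : E.Vertex) (h : {f | E.s f = v}.Finite), {f | E.s f = v}.Nonempty →
    a (.vertex v) = ∑ f ∈ h.toFinset, a (.edge f) * a (.ghost f)

open Classical in
/-- The smallest relation on the free algebra that contains the defining relations of the
Leavitt path algebra and is compatible with the operations. -/
inductive LPARel (R : Type v) [CommRing R] : FreeAlg E R → FreeAlg E R → Prop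
  | vertex_mul_vertex (v v' : E.Vertex) : LPARel R
      (FreeAlg.of E R (.vertex v) * FreeAlg.of E R (.vertex v'))
      (if v = v' then FreeAlg.of E R (.vertex v) else 0)
  | source_mul_edge (f : E.Edge) : LPARel R
      (FreeAlg.of E R (.vertex (E.s f)) * FreeAlg.of E R (.edge f)) (FreeAlg.of E R (.edge f))
  | edge_mul_range (f : E.Edge) : LPARel R
      (FreeAlg.of E R (.edge f) * FreeAlg.of E R (.vertex (E.r f))) (FreeAlg.of E R (.edge f))
  | range_mul_ghost (f : E.Edge) : LPARel R
      (FreeAlg.of E R (.vertex (E.r f)) * FreeAlg.of E R (.ghost f)) (FreeAlg.of E R (.ghost f))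
  | ghost_mul_source (f : E.Edge) : LPARel R
      (FreeAlg.of E R (.ghost f) * FreeAlg.of E R (.vertex (E.s f))) (FreeAlg.of E R (.ghost f))
  | ghost_mul_edge (f f' : E.Edge) : LPARel R
      (FreeAlg.of E R (.ghost f) * FreeAlg.of E R (.edge f'))
      (if f = f' then FreeAlg.of E R (.vertex (E.r f)) else 0)
  | sum_edge_mul_ghost (v : E.Vertex) (h : {f | E.s f = v}.Finite) :
      {f | E.s f = v}.Nonempty → LPARel R (FreeAlg.of E R (.vertex v))
        (∑ f ∈ h.toFinset, FreeAlg.of E R (.edge f) * FreeAlg.of E R (.ghost f))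
  | smul (t : R) {a b : FreeAlg E R} : LPARel R a b → LPARel R (t • a) (t • b)
  | add_right {a b : FreeAlg E R} (c : FreeAlg E R) : LPARel R a b → LPARel R (a + c) (b + c)
  | mul_left (a : FreeAlg E R) {b c : FreeAlg E R} : LPARel R b c → LPARel R (a * b) (a * c)
  | mul_right {a b : FreeAlg E R} (c : FreeAlg E R) : LPARel R a b → LPARel R (a * c) (b * c)

/-- The Leavitt path algebra `L_R(E)`, as an algebra that need not have an identity element: the
free algebra on vertices, edges and ghost edges modulo the ideal of the relations. -/
def LPA (R : Type v) [CommRing R] : Type (max u v) := Quot (E.LPARel R)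

section LPARel

variable {E} {R : Type v} [CommRing R]

theorem LPARel.addLeft (a : FreeAlg E R) {b c : FreeAlg E R} (h : LPARel E R b c) :
    LPARel E R (a + b) (a + c) := by
  rw [add_comm _ b, add_comm _ c]
  exact h.add_right _

theorem LPARel.neg {a b : FreeAlg E R} (h : LPARel E R a b) : LPARel E R (-a) (-b) := by
  simpa only [neg_one_smul] using h.smul (-1)

theorem LPARel.subLeft (a : FreeAlg E R) {b c : FreeAlg E R} (h : LPARel E R b c) :
    LPARel E R (a - b) (a - c) := by
  simpa only [sub_eq_add_neg] using h.neg.addLeft a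

theorem LPARel.subRight {a b : FreeAlg E R} (c : FreeAlg E R) (h : LPARel E R a b) :
    LPARel E R (a - c) (b - c) := by
  simpa only [sub_eq_add_neg] using h.add_right (-c)

theorem LPARel.smulOfTower {S : Type w} [CommRing S] [Algebra S R] (t : S) {a b : FreeAlg E R}
    (h : LPARel E R a b) : LPARel E R (t • a) (t • b) := by
  rw [← smul_one_smul R t a, ← smul_one_smul R t b]
  exact h.smul _

end LPARel

namespace LPA

variable {E} {R : Type v} [CommRing R]

instance instSMul {S : Type w} [CommRing S] [Algebra S R] : SMul S (E.LPA R) where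
  smul t := Quot.map (t • ·) (fun _ _ => LPARel.smulOfTower t)

instance instZero : Zero (E.LPA R) where zero := Quot.mk _ 0

instance instAdd : Add (E.LPA R) where
  add := Quot.map₂ (· + ·) (fun _ _ _ => LPARel.addLeft _) fun _ _ _ => LPARel.add_right _

instance instNeg : Neg (E.LPA R) where neg := Quot.map Neg.neg fun _ _ => LPARel.neg

instance instSub : Sub (E.LPA R) where
  sub := Quot.map₂ Sub.sub (fun _ _ _ => LPARel.subLeft _) fun _ _ _ => LPARel.subRight _

instance instMul : Mul (E.LPA R) where
  mul := Quot.map₂ (· * ·) (fun _ _ _ => LPARel.mul_left _) fun _ _ _ => LPARel.mul_right _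

instance instSMulNat : SMul ℕ (E.LPA R) where
  smul n := Quot.map (n • ·) (fun a b h => by
    have := LPARel.smul (n : R) h
    simpa only [Nat.cast_smul_eq_nsmul] using this)

instance instSMulInt : SMul ℤ (E.LPA R) where
  smul n := Quot.map (n • ·) (fun a b h => by
    have := LPARel.smul (n : R) h
    simpa only [Int.cast_smul_eq_zsmul] using this)

instance instNonUnitalRing : NonUnitalRing (E.LPA R) :=
  Function.Surjective.nonUnitalRing (Quot.mk _) Quot.mk_surjective rfl (fun _ _ => rfl)
    (fun _ _ => rfl) (fun _ => rfl) (fun _ _ => rfl) (fun _ _ => rfl) (fun _ _ => rfl)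

instance instModule {S : Type w} [CommRing S] [Algebra S R] : Module S (E.LPA R) :=
  Function.Surjective.module S
    (⟨⟨Quot.mk (E.LPARel R), rfl⟩, fun _ _ => rfl⟩ : FreeAlg E R →+ E.LPA R)
    Quot.mk_surjective (fun _ _ => rfl)

instance instIsScalarTower {S : Type w} [CommRing S] [Algebra S R] :
    IsScalarTower S (E.LPA R) (E.LPA R) where
  smul_assoc := by
    rintro t ⟨a⟩ ⟨b⟩
    exact congrArg (Quot.mk _) (smul_mul_assoc t a b)

instance instSMulCommClass {S : Type w} [CommRing S] [Algebra S R] :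
    SMulCommClass S (E.LPA R) (E.LPA R) where
  smul_comm := by
    rintro t ⟨a⟩ ⟨b⟩
    exact congrArg (Quot.mk _) (mul_smul_comm t a b).symm

instance instIsScalarTower' {S : Type w} [CommRing S] [Algebra S R] :
    IsScalarTower S R (E.LPA R) where
  smul_assoc := by
    rintro t k ⟨a⟩
    exact congrArg (Quot.mk _) (smul_assoc t k a)

variable (R) in
/-- The generators in the Leavitt path algebra. -/
def of (g : E.Gen) : E.LPA R := Quot.mk _ (FreeAlg.of E R g)

variable (E R) in
/-- The quotient map from the free algebra. -/
def mkHom : FreeAlg E R →ₙₐ[R] E.LPA R where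
  toFun := Quot.mk _
  map_smul' _ _ := rfl
  map_zero' := rfl
  map_add' _ _ := rfl
  map_mul' _ _ := rfl

open Classical in
theorem isLeavittFamily_of : E.IsLeavittFamily (of R : E.Gen → E.LPA R) where
  vertex_mul_vertex v v' := by
    refine (Quot.sound (LPARel.vertex_mul_vertex v v')).trans ?_
    split_ifs <;> rfl
  source_mul_edge f := Quot.sound (LPARel.source_mul_edge f)
  edge_mul_range f := Quot.sound (LPARel.edge_mul_range f)
  range_mul_ghost f := Quot.sound (LPARel.range_mul_ghost f)
  ghost_mul_source f := Quot.sound (LPARel.ghost_mul_source f)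
  ghost_mul_edge f f' := by
    refine (Quot.sound (LPARel.ghost_mul_edge f f')).trans ?_
    split_ifs <;> rfl
  sum_edge_mul_ghost v h hne := by
    refine (Quot.sound (LPARel.sum_edge_mul_ghost v h hne)).trans ?_
    exact map_sum (mkHom E R) _ _

section lift

variable {A : Type w} [NonUnitalRing A] [Module R A] [IsScalarTower R A A] [SMulCommClass R A A]

/-- The homomorphism from the free algebra with prescribed values on the generators. -/
def freeLift (a : E.Gen → A) : FreeAlg E R →ₙₐ[R] A :=
  MonoidAlgebra.liftMagma R (FreeSemigroup.lift a)

theorem freeLift_of (a : E.Gen → A) (g : E.Gen) : freeLift (R := R) a (FreeAlg.of E R g) = a g := by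
  simp [freeLift, FreeAlg.of]

theorem freeLift_rel (a : E.Gen → A) (ha : E.IsLeavittFamily a) {x y : FreeAlg E R}
    (h : LPARel E R x y) : freeLift (R := R) a x = freeLift (R := R) a y := by
  induction h with
  | vertex_mul_vertex v v' =>
    rw [map_mul, freeLift_of, freeLift_of, ha.vertex_mul_vertex]
    split_ifs
    · rw [freeLift_of]
    · rw [map_zero]
  | source_mul_edge f => simp only [map_mul, freeLift_of, ha.source_mul_edge]
  | edge_mul_range f => simp only [map_mul, freeLift_of, ha.edge_mul_range]
  | range_mul_ghost f => simp only [map_mul, freeLift_of, ha.range_mul_ghost]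
  | ghost_mul_source f => simp only [map_mul, freeLift_of, ha.ghost_mul_source]
  | ghost_mul_edge f f' =>
    rw [map_mul, freeLift_of, freeLift_of, ha.ghost_mul_edge]
    split_ifs
    · rw [freeLift_of]
    · rw [map_zero]
  | sum_edge_mul_ghost v h hne =>
    rw [map_sum, freeLift_of, ha.sum_edge_mul_ghost v h hne]
    simp only [map_mul, freeLift_of]
  | smul t _ ih => rw [map_smul, map_smul, ih]
  | add_right c _ ih => rw [map_add, map_add, ih]
  | mul_left c _ ih => rw [map_mul, map_mul, ih]
  | mul_right c _ ih => rw [map_mul, map_mul, ih]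

/-- The universal property of the Leavitt path algebra. -/
def lift (a : E.Gen → A) (ha : E.IsLeavittFamily a) : E.LPA R →ₙₐ[R] A where
  toFun := Quot.lift (freeLift (R := R) a) (fun _ _ => freeLift_rel a ha)
  map_smul' := by
    rintro t ⟨x⟩
    exact map_smul (freeLift (R := R) a) t x
  map_zero' := map_zero (freeLift (R := R) a)
  map_add' := by
    rintro ⟨x⟩ ⟨y⟩
    exact map_add (freeLift (R := R) a) x y
  map_mul' := by
    rintro ⟨x⟩ ⟨y⟩
    exact map_mul (freeLift (R := R) a) x y

@[simp] theorem lift_of (a : E.Gen → A) (ha : E.IsLeavittFamily a) (g : E.Gen) :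
    lift (R := R) a ha (of R g) = a g :=
  freeLift_of a g

end lift

/-- Induction on the elements of the Leavitt path algebra. -/
theorem induction {P : E.LPA R → Prop} (zero : P 0) (gen : ∀ g, P (of R g))
    (gen_mul : ∀ g x, P x → P (of R g * x)) (add : ∀ x y, P x → P y → P (x + y))
    (smul : ∀ (t : R) x, P x → P (t • x)) (x : E.LPA R) : P x := by
  obtain ⟨x, rfl⟩ := Quot.exists_rep x
  change P (mkHom E R x)
  induction x using MonoidAlgebra.induction_linear with
  | zero => rw [map_zero]; exact zero
  | add x y hx hy => rw [map_add]; exact add _ _ hx hy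
  | single m t =>
    have h1 : (MonoidAlgebra.single m t : FreeAlg E R) = t • MonoidAlgebra.single m 1 := by
      rw [MonoidAlgebra.smul_single, smul_eq_mul, mul_one]
    rw [h1, map_smul]
    clear h1
    refine smul _ _ ?_
    induction m using FreeSemigroup.recOnMul with
    | ih1 g => exact gen g
    | ih2 g m _ ih =>
      have h2 : (MonoidAlgebra.single (FreeSemigroup.of g * m) 1 : FreeAlg E R) =
          FreeAlg.of E R g * MonoidAlgebra.single m 1 := by
        rw [FreeAlg.of, MonoidAlgebra.single_mul_single, mul_one]
      rw [h2, map_mul]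
      exact gen_mul _ _ ih

variable (E) in
/-- The natural map `L_K(E) → L_R(E)` for a `K`-algebra `R`; it fixes vertices, edges and
ghost edges. -/
def baseChange (K : Type w) [CommRing K] [Algebra K R] : E.LPA K →ₙₐ[K] E.LPA R :=
  lift (of R) isLeavittFamily_of

open Classical in
/-- The values on the generators of the gauge automorphism associated with an edge `e₁` and a
unit `a`. -/
def gaugeFun (e₁ : E.Edge) (a : Rˣ) : E.Gen → E.LPA R
  | .vertex v => of R (.vertex v)
  | .edge f => if f = e₁ then (a : R) • of R (.edge f) else of R (.edge f)
  | .ghost f => if f = e₁ then ((a⁻¹ : Rˣ) : R) • of R (.ghost f) else of R (.ghost f)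

theorem isLeavittFamily_gaugeFun (e₁ : E.Edge) (a : Rˣ) :
    E.IsLeavittFamily (gaugeFun (R := R) e₁ a) where
  vertex_mul_vertex v v' := isLeavittFamily_of.vertex_mul_vertex v v'
  source_mul_edge f := by
    have := (isLeavittFamily_of (R := R)).source_mul_edge f
    simp only [gaugeFun]
    split_ifs
    · rw [mul_smul_comm, this]
    · exact this
  edge_mul_range f := by
    have := (isLeavittFamily_of (R := R)).edge_mul_range f
    simp only [gaugeFun]
    split_ifs
    · rw [smul_mul_assoc, this]
    · exact this
  range_mul_ghost f := by
    have := (isLeavittFamily_of (R := R)).range_mul_ghost f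
    simp only [gaugeFun]
    split_ifs
    · rw [mul_smul_comm, this]
    · exact this
  ghost_mul_source f := by
    have := (isLeavittFamily_of (R := R)).ghost_mul_source f
    simp only [gaugeFun]
    split_ifs
    · rw [smul_mul_assoc, this]
    · exact this
  ghost_mul_edge f f' := by
    have := (isLeavittFamily_of (R := R)).ghost_mul_edge f f'
    simp only [gaugeFun]
    by_cases hff : f = f'
    · subst hff
      by_cases hf : f = e₁
      · simp only [hf, if_true] at this ⊢
        rw [smul_mul_assoc, mul_smul_comm, smul_smul, Units.inv_mul, one_smul, this]
      · simpa only [hf, if_false, if_true] using this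
    · simp only [hff, if_false] at this ⊢
      split_ifs <;> simp only [smul_mul_assoc, mul_smul_comm, this, smul_zero]
  sum_edge_mul_ghost v h hne := by
    refine ((isLeavittFamily_of (R := R)).sum_edge_mul_ghost v h hne).trans ?_
    refine Finset.sum_congr rfl fun f _ => ?_
    simp only [gaugeFun]
    split_ifs
    · rw [smul_mul_assoc, mul_smul_comm, smul_smul, Units.mul_inv, one_smul]
    · rfl

/-- The gauge automorphism `σ` associated with an edge `e₁` and a unit `a`: `e₁ ↦ a e₁`,
`e₁* ↦ a⁻¹ e₁*`, and all other generators are fixed. -/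
def gauge (e₁ : E.Edge) (a : Rˣ) : E.LPA R →ₙₐ[R] E.LPA R :=
  lift (gaugeFun e₁ a) (isLeavittFamily_gaugeFun e₁ a)

end LPA

/-! ### The modules `V_{[e^∞]}` and `V^p_{[e^∞]}` -/

section Chen

variable {E} (R : Type v) [CommRing R] (c : E.Cycle)

open Classical in
/-- The action of the generators on the free `R`-module with basis `[c^∞]`. -/
def chenFun : E.Gen → Module.End R (c.TailClass →₀ R)
  | .vertex v => Finsupp.linearCombination R fun x =>
      if v = x.1.source then Finsupp.single x 1 else 0
  | .edge f => Finsupp.linearCombination R fun x =>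
      if h : E.r f = x.1.source then
        Finsupp.single ⟨x.1.cons f h, InfPath.tailEquiv_cons x.2 f h⟩ 1 else 0
  | .ghost f => Finsupp.linearCombination R fun x =>
      if f = x.1.edge 0 then Finsupp.single ⟨x.1.tail, InfPath.tailEquiv_tail x.2⟩ 1 else 0

theorem chenFun_vertex_single (v : E.Vertex) (x : c.TailClass) (t : R) [Decidable (v = x.1.source)] :
    chenFun R c (.vertex v) (Finsupp.single x t) =
      if v = x.1.source then Finsupp.single x t else 0 := by
  simp only [chenFun, Finsupp.linearCombination_single]
  split_ifs <;> simp

theorem chenFun_edge_single (f : E.Edge) (x : c.TailClass) (t : R)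
    [Decidable (E.r f = x.1.source)] :
    chenFun R c (.edge f) (Finsupp.single x t) =
      if h : E.r f = x.1.source then
        Finsupp.single ⟨x.1.cons f h, InfPath.tailEquiv_cons x.2 f h⟩ t else 0 := by
  simp only [chenFun, Finsupp.linearCombination_single]
  split_ifs <;> simp

theorem chenFun_ghost_single (f : E.Edge) (x : c.TailClass) (t : R) [Decidable (f = x.1.edge 0)] :
    chenFun R c (.ghost f) (Finsupp.single x t) =
      if f = x.1.edge 0 then
        Finsupp.single ⟨x.1.tail, InfPath.tailEquiv_tail x.2⟩ t else 0 := by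
  simp only [chenFun, Finsupp.linearCombination_single]
  split_ifs <;> simp

theorem InfPath.source_cons (f : E.Edge) (x : E.InfPath) (h : E.r f = x.source) :
    (x.cons f h).source = E.s f := rfl

theorem InfPath.edge_zero_cons (f : E.Edge) (x : E.InfPath) (h : E.r f = x.source) :
    (x.cons f h).edge 0 = f := rfl

theorem InfPath.tail_cons (f : E.Edge) (x : E.InfPath) (h : E.r f = x.source) :
    (x.cons f h).tail = x := rfl

theorem InfPath.source_tail (x : E.InfPath) : x.tail.source = E.r (x.edge 0) := (x.chain 0).symm

theorem InfPath.cons_tail (x : E.InfPath) :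
    x.tail.cons (x.edge 0) x.source_tail.symm = x := by
  ext n
  cases n <;> rfl

open Classical in
theorem isLeavittFamily_chenFun : E.IsLeavittFamily (chenFun R c) where
  vertex_mul_vertex v v' := by
    refine Finsupp.lhom_ext fun x t => ?_
    rw [Module.End.mul_apply, chenFun_vertex_single]
    by_cases h : v = v' <;> by_cases h' : v' = x.1.source <;>
      simp_all [chenFun_vertex_single]
  source_mul_edge f := by
    refine Finsupp.lhom_ext fun x t => ?_
    rw [Module.End.mul_apply, chenFun_edge_single]
    split_ifs with h
    · rw [chenFun_vertex_single, InfPath.source_cons, if_pos rfl]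
    · rw [map_zero]
  edge_mul_range f := by
    refine Finsupp.lhom_ext fun x t => ?_
    rw [Module.End.mul_apply, chenFun_vertex_single]
    split_ifs with h
    · rfl
    · rw [map_zero, chenFun_edge_single, dif_neg h]
  range_mul_ghost f := by
    refine Finsupp.lhom_ext fun x t => ?_
    rw [Module.End.mul_apply, chenFun_ghost_single]
    split_ifs with h
    · rw [chenFun_vertex_single, InfPath.source_tail, if_pos (by rw [h])]
    · rw [map_zero]
  ghost_mul_source f := by
    refine Finsupp.lhom_ext fun x t => ?_
    rw [Module.End.mul_apply, chenFun_vertex_single]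
    split_ifs with h
    · rfl
    · rw [map_zero, chenFun_ghost_single, if_neg]
      rintro rfl
      exact h rfl
  ghost_mul_edge f f' := by
    refine Finsupp.lhom_ext fun x t => ?_
    rw [Module.End.mul_apply, chenFun_edge_single]
    by_cases hr : E.r f' = x.1.source
    · rw [dif_pos hr, chenFun_ghost_single]
      by_cases h : f = f'
      · subst h
        rw [if_pos (InfPath.edge_zero_cons _ _ _).symm, if_pos rfl, chenFun_vertex_single,
          if_pos hr]
        rfl
      · rw [if_neg h, LinearMap.zero_apply]
        exact if_neg h
    · rw [dif_neg hr, map_zero]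
      split_ifs with h
      · subst h
        rw [chenFun_vertex_single, if_neg hr]
      · rfl
  sum_edge_mul_ghost v h hne := by
    refine Finsupp.lhom_ext fun x t => ?_
    rw [LinearMap.sum_apply, chenFun_vertex_single]
    have key : ∀ f, (chenFun R c (.edge f) * chenFun R c (.ghost f)) (Finsupp.single x t) =
        if f = x.1.edge 0 then Finsupp.single x t else 0 := by
      intro f
      rw [Module.End.mul_apply, chenFun_ghost_single]
      split_ifs with hf
      · subst hf
        rw [chenFun_edge_single, dif_pos (InfPath.source_tail x.1).symm]
        simp only [InfPath.cons_tail]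
      · rw [map_zero]
    simp only [key, Finset.sum_ite_eq', Set.Finite.mem_toFinset, Set.mem_ofPred_eq]
    exact if_congr ⟨fun e => e.symm, fun e => e.symm⟩ rfl rfl

/-- The representation of `L_R(E)` on the module `V_{[c^∞]}`, which is the free `R`-module with
basis `[c^∞]`. -/
def chenRep : E.LPA R →ₙₐ[R] Module.End R (c.TailClass →₀ R) :=
  LPA.lift (chenFun R c) (isLeavittFamily_chenFun R c)

end Chen

/-! ### Unital modules -/

section Unital

variable (K : Type v) [Field K]

/-- Left modules over `L_K(E)`, viewed as modules over the `K`-algebra obtained from `L_K(E)` by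
adjoining an identity element. -/
abbrev AllModules : Type (max (u + 1) (v + 1)) :=
  ModuleCat.{max u v} (Unitization K (E.LPA K))

/-- A left module `M` is unital if `L_K(E) M = M`. (The `K`-vector space structure of such a module
is determined by the action of `L_K(E)`.) -/
def isUnital : ObjectProperty (E.AllModules K) := fun M =>
  AddSubgroup.closure {y : M | ∃ (a : E.LPA K) (x : M), y = (a : Unitization K (E.LPA K)) • x} = ⊤

/-- The `K`-linear category of unital left `L_K(E)`-modules. -/
abbrev UnitalModules : Type (max (u + 1) (v + 1)) := (E.isUnital K).FullSubcategory

variable {E K}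

open Classical in
/-- The sum of finitely many vertices. -/
def LPA.unit (F : Finset E.Vertex) : E.LPA K := ∑ v ∈ F, LPA.of K (.vertex v)

open Classical in
theorem LPA.unit_mul_unit {F G : Finset E.Vertex} (h : F ⊆ G) :
    (LPA.unit G : E.LPA K) * LPA.unit F = LPA.unit F := by
  simp only [LPA.unit, Finset.sum_mul_sum]
  rw [Finset.sum_comm]
  refine Finset.sum_congr rfl fun v hv => ?_
  simp only [LPA.isLeavittFamily_of.vertex_mul_vertex]
  rw [Finset.sum_ite_eq', if_pos (h hv)]

theorem LPA.unit_mul_mono {F G : Finset E.Vertex} (h : F ⊆ G) {a : E.LPA K}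
    (ha : LPA.unit F * a = a) : LPA.unit G * a = a := by
  rw [← ha, ← mul_assoc, LPA.unit_mul_unit h]

theorem LPA.exists_gen (g : E.Gen) : ∃ v : E.Vertex, LPA.of K (.vertex v) * LPA.of K g = LPA.of K g := by
  cases g with
  | vertex v => exact ⟨v, by rw [LPA.isLeavittFamily_of.vertex_mul_vertex, if_pos rfl]⟩
  | edge f => exact ⟨E.s f, LPA.isLeavittFamily_of.source_mul_edge f⟩
  | ghost f => exact ⟨E.r f, LPA.isLeavittFamily_of.range_mul_ghost f⟩

open Classical in
/-- The finite sums of vertices are local units. -/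
theorem LPA.exists_unit (a : E.LPA K) : ∃ F : Finset E.Vertex, LPA.unit F * a = a := by
  induction a using LPA.induction with
  | zero => exact ⟨∅, mul_zero _⟩
  | gen g =>
    obtain ⟨v, hv⟩ := LPA.exists_gen (K := K) g
    exact ⟨{v}, by rw [LPA.unit, Finset.sum_singleton, hv]⟩
  | gen_mul g x _ =>
    obtain ⟨v, hv⟩ := LPA.exists_gen (K := K) g
    exact ⟨{v}, by rw [LPA.unit, Finset.sum_singleton, ← mul_assoc, hv]⟩
  | add x y hx hy =>
    obtain ⟨F, hF⟩ := hx
    obtain ⟨G, hG⟩ := hy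
    refine ⟨F ∪ G, ?_⟩
    rw [mul_add, LPA.unit_mul_mono Finset.subset_union_left hF,
      LPA.unit_mul_mono Finset.subset_union_right hG]
  | smul t x hx =>
    obtain ⟨F, hF⟩ := hx
    exact ⟨F, by rw [mul_smul_comm, hF]⟩

theorem unit_smul_mono {M : E.AllModules K} {F G : Finset E.Vertex} (h : F ⊆ G) {x : M}
    (hx : ((LPA.unit F : E.LPA K) : Unitization K (E.LPA K)) • x = x) :
    ((LPA.unit G : E.LPA K) : Unitization K (E.LPA K)) • x = x := by
  rw [← hx, smul_smul, ← Unitization.inr_mul, LPA.unit_mul_unit h]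

open Classical in
theorem isUnital_iff (M : E.AllModules K) : E.isUnital K M ↔ ∀ x : M, ∃ F : Finset E.Vertex,
    ((LPA.unit F : E.LPA K) : Unitization K (E.LPA K)) • x = x := by
  constructor
  · intro h x
    have hx : x ∈ AddSubgroup.closure
        {y : M | ∃ (a : E.LPA K) (z : M), y = (a : Unitization K (E.LPA K)) • z} := by
      rw [show AddSubgroup.closure _ = ⊤ from h]
      trivial
    induction hx using AddSubgroup.closure_induction with
    | mem y hy =>
      obtain ⟨a, z, rfl⟩ := hy
      obtain ⟨F, hF⟩ := LPA.exists_unit a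
      exact ⟨F, by rw [smul_smul, ← Unitization.inr_mul, hF]⟩
    | zero => exact ⟨∅, smul_zero _⟩
    | add y z _ _ hy hz =>
      obtain ⟨F, hF⟩ := hy
      obtain ⟨G, hG⟩ := hz
      refine ⟨F ∪ G, ?_⟩
      rw [smul_add, unit_smul_mono Finset.subset_union_left hF,
        unit_smul_mono Finset.subset_union_right hG]
    | neg y _ hy =>
      obtain ⟨F, hF⟩ := hy
      exact ⟨F, by rw [smul_neg, hF]⟩
  · intro h
    refine eq_top_iff.mpr fun x _ => ?_
    obtain ⟨F, hF⟩ := h x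
    exact AddSubgroup.subset_closure ⟨LPA.unit F, x, hF.symm⟩

variable (E K)

instance : (E.isUnital K).IsClosedUnderSubobjects where
  prop_of_mono {X Y} f _ hY := by
    rw [isUnital_iff] at hY ⊢
    intro x
    obtain ⟨F, hF⟩ := hY (f.hom x)
    refine ⟨F, (ModuleCat.mono_iff_injective f).mp inferInstance ?_⟩
    exact (map_smul f.hom _ _).trans hF

instance : (E.isUnital K).IsClosedUnderQuotients where
  prop_of_epi {X Y} f _ hX := by
    rw [isUnital_iff] at hX ⊢
    intro y
    obtain ⟨x, rfl⟩ := (ModuleCat.epi_iff_surjective f).mp inferInstance y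
    obtain ⟨F, hF⟩ := hX x
    exact ⟨F, (map_smul f.hom _ _).symm.trans (congrArg f.hom hF)⟩

instance : (E.isUnital K).ContainsZero where
  exists_zero := by
    refine ⟨ModuleCat.of _ PUnit, ModuleCat.isZero_of_subsingleton _, ?_⟩
    rw [isUnital_iff]
    exact fun x => ⟨∅, rfl⟩

open Classical in
instance : (E.isUnital K).IsClosedUnderFiniteProducts where
  isClosedUnderLimitsOfShape J _ := by
    refine ⟨?_⟩
    rintro X ⟨pr⟩
    rw [isUnital_iff]
    intro x
    have hj := fun j : J => (isUnital_iff _).mp (pr.prop_diag_obj ⟨j⟩) ((pr.π.app ⟨j⟩).hom x)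
    choose F hF using hj
    have := Fintype.ofFinite J
    refine ⟨Finset.univ.biUnion F, Limits.Concrete.isLimit_ext _ pr.isLimit _ _ ?_⟩
    rintro ⟨j⟩
    refine (map_smul (pr.π.app ⟨j⟩).hom _ _).trans ?_
    exact unit_smul_mono (Finset.subset_biUnion_of_mem F (Finset.mem_univ j)) (hF j)

/-- Extension groups exist in the category of unital modules. -/
instance : HasExt.{max (u + 1) (v + 1)} (E.UnitalModules K) := HasExt.standard _

end Unital

/-! ### The modules `V^p_{[c^∞]}` -/

section Twisted

variable {E} {K : Type v} [Field K]

/-- Basic irreducible polynomials: irreducible with constant term `-1`. -/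
def IsBasicIrreducible (p : K[X]) : Prop := Irreducible p ∧ p.coeff 0 = -1

theorem IsBasicIrreducible.isUnit_root {p : K[X]} (hp : IsBasicIrreducible p) :
    IsUnit (AdjoinRoot.root p) := by
  have h : AdjoinRoot.mk p (p.divX * X + C (p.coeff 0)) = 0 := by
    rw [Polynomial.divX_mul_X_add, AdjoinRoot.mk_self]
  rw [hp.2, map_add, map_mul, AdjoinRoot.mk_X, map_neg, map_one, map_neg, map_one,
    add_neg_eq_zero] at h
  exact IsUnit.of_mul_eq_one_right _ h

variable (c : E.Cycle) (p : K[X]) (hp : IsBasicIrreducible p)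

/-- The representation of `L_K(E)` on `V_{[c^∞]}`, over `K' = K[x]/(p)`, obtained from the one of
`L_{K'}(E)` by twisting with the gauge automorphism that is associated with the first edge of `c`
and the class of `x`, and by restricting scalars to `L_K(E)`. -/
def twistedRep : E.LPA K →ₙₐ[K] Module.End (AdjoinRoot p) (c.TailClass →₀ AdjoinRoot p) :=
  (((chenRep (AdjoinRoot p) c).comp (LPA.gauge c.first hp.isUnit_root.unit)).restrictScalars K).comp
    (LPA.baseChange E K)

theorem twistedRep_of (g : E.Gen) : twistedRep c p hp (LPA.of K g) =
    chenRep (AdjoinRoot p) c (LPA.gaugeFun c.first hp.isUnit_root.unit g) := by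
  have h1 : LPA.baseChange (R := AdjoinRoot p) E K (LPA.of K g) = LPA.of (AdjoinRoot p) g :=
    LPA.lift_of _ _ _
  have h2 : LPA.gauge c.first hp.isUnit_root.unit (LPA.of (AdjoinRoot p) g) =
    LPA.gaugeFun c.first hp.isUnit_root.unit g := LPA.lift_of _ _ _
  rw [← h2, ← h1]
  rfl

/-- The underlying set of `V^p_{[c^∞]}`. -/
def TwistedSpace (_ : IsBasicIrreducible p) : Type (max u v) := c.TailClass →₀ AdjoinRoot p

instance : AddCommGroup (TwistedSpace c p hp) :=
  inferInstanceAs (AddCommGroup (c.TailClass →₀ AdjoinRoot p))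

instance : Module (Unitization K (E.LPA K)) (TwistedSpace c p hp) :=
  letI : Module (Module.End (AdjoinRoot p) (c.TailClass →₀ AdjoinRoot p)) (TwistedSpace c p hp) :=
    inferInstanceAs (Module (Module.End (AdjoinRoot p) (c.TailClass →₀ AdjoinRoot p))
      (c.TailClass →₀ AdjoinRoot p))
  Module.compHom (TwistedSpace c p hp) (Unitization.lift (twistedRep c p hp)).toRingHom

theorem TwistedSpace.smul_def (a : E.LPA K) (x : TwistedSpace c p hp) :
    (a : Unitization K (E.LPA K)) • x =
      (twistedRep c p hp a : Module.End (AdjoinRoot p) (c.TailClass →₀ AdjoinRoot p)) x := by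
  change (Unitization.lift (twistedRep c p hp) (a : Unitization K (E.LPA K))) x = _
  have h : Unitization.lift (twistedRep c p hp) (a : Unitization K (E.LPA K)) =
    twistedRep c p hp a := by simp
  rw [h]

theorem isUnital_twistedSpace :
    E.isUnital K (ModuleCat.of (Unitization K (E.LPA K)) (TwistedSpace c p hp)) := by
  refine eq_top_iff.mpr fun x _ => ?_
  change c.TailClass →₀ AdjoinRoot p at x
  induction x using Finsupp.induction_linear with
  | zero => exact zero_mem _
  | add x y hx hy => exact add_mem (hx trivial) (hy trivial)
  | single y t =>
    classical
    refine AddSubgroup.subset_closure ⟨LPA.of K (.vertex y.1.source), Finsupp.single y t, ?_⟩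
    refine Eq.trans ?_ (TwistedSpace.smul_def c p hp _ _).symm
    rw [twistedRep_of, LPA.gaugeFun, chenRep, LPA.lift_of, chenFun_vertex_single, if_pos rfl]

/-- The unital left `L_K(E)`-module `V^p_{[c^∞]}`. -/
def V : E.UnitalModules K :=
  ⟨ModuleCat.of (Unitization K (E.LPA K)) (TwistedSpace c p hp), isUnital_twistedSpace c p hp⟩

end Twisted

end DirectedGraph

end

/-! Let `v` be the source of `c`, write `L` for the Leavitt path algebra with an identity element
adjoined, and `K'` for `K[x]/(q)`. The theorem comes from a projective resolution of length one of
`V^p_{[c^∞]}`.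

Going once round `c` fixes `c^∞` and multiplies it by the class of `x`, so `p(c)` annihilates `c^∞`,
and `a ↦ a c^∞` maps `L v` onto `V^p_{[c^∞]}` (`exists_smul_base`). The kernel is `L p(c)`: any
vector `w` with `v w = w` and `p(c) w = 0` is the image of `c^∞` under a module map
(`universalLin`), and this applies to the class of `v` modulo `L p(c)` (`exists_mul_polyElt`). Right
multiplication by `p(c)` is injective on `L v`: since `p(0) = -1`, the equation `a p(c) = 0`
expresses `a` as `a` times terms of positive degree, which is impossible for `a ≠ 0` in a `ℤ`-graded
algebra (`eq_zero_of_mul_polyElt`). Hence `0 → L v → L v → V^p_{[c^∞]} → 0` is exact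
(`resolution_shortExact`). As `Hom(L v, N) = v N` and `L v` is projective, `Ext¹(V^p_{[c^∞]}, N)` is
the cokernel of `p(c)` on `v N` (`nonempty_ext_equiv`).

For `N = V^q_{[e^∞]}` the space `v N` has as `K'`-basis the paths of `[e^∞]` that start at `v`. If
`c` is a cyclic permutation of `e`, exclusivity leaves only `c^∞` (`IsExclusive.eq_infty`), so `v N`
is `K'`, and `p(c)` is multiplication by the class of `p`: zero for `p = q`, invertible otherwise.
If not, `c^∞` is not in `[e^∞]`, and each path is `cⁿ λ` for exactly one `n` and one `λ` in
`L_{c,e}` (`exists_prepend_eq`, `prepend_injective`). Since `c` avoids the twisted edge of `e`, it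
acts by `cⁿ λ ↦ cⁿ⁺¹ λ`. So `v N` is a direct sum of copies of `K'[x]` indexed by `L_{c,e}`, and the
cokernel is a direct sum of copies of `K'[x]/(p)`, each of dimension `deg p · deg q` over `K`. -/

noncomputable section

namespace DirectedGraph

/-! ### Infinite paths: initial segments and shifts -/

namespace InfPath

variable {E : DirectedGraph.{u}}

/-- The infinite path obtained by deleting the first `m` edges. -/
def shift (m : ℕ) (x : E.InfPath) : E.InfPath where
  edge n := x.edge (m + n)
  chain n := x.chain (m + n)

/-- The list of the first `m` edges of an infinite path. -/
def take (m : ℕ) (x : E.InfPath) : List E.Edge := (List.range m).map x.edge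

@[simp] theorem shift_zero (x : E.InfPath) : shift 0 x = x := by
  ext n
  simp [shift]

theorem shift_tail (m : ℕ) (x : E.InfPath) : shift m x.tail = shift (m + 1) x := by
  ext n
  simp only [shift, tail]
  congr 1
  omega

theorem shift_shift (m k : ℕ) (x : E.InfPath) : shift k (shift m x) = shift (m + k) x := by
  ext n
  simp only [shift, add_assoc]

@[simp] theorem take_zero (x : E.InfPath) : take 0 x = [] := rfl

theorem take_succ (m : ℕ) (x : E.InfPath) : take (m + 1) x = x.edge 0 :: take m x.tail := by
  simp [take, List.range_succ_eq_map, Function.comp_def, tail]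

theorem take_add (m k : ℕ) (x : E.InfPath) : take (m + k) x = take m x ++ take k (shift m x) := by
  simp [take, List.range_add, Function.comp_def, shift]

theorem tailEquiv_shift {x y : E.InfPath} (h : x.TailEquiv y) (m : ℕ) :
    (shift m x).TailEquiv y := by
  induction m generalizing x with
  | zero => simpa using h
  | succ m ih =>
    rw [← shift_tail]
    exact ih (tailEquiv_tail h)

theorem TailEquiv.symm {x y : E.InfPath} (h : x.TailEquiv y) : y.TailEquiv x := by
  obtain ⟨m, n, h⟩ := h
  exact ⟨n, m, fun k => (h k).symm⟩

theorem TailEquiv.trans {x y z : E.InfPath} (h : x.TailEquiv y) (h' : y.TailEquiv z) :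
    x.TailEquiv z := by
  obtain ⟨m, n, h⟩ := h
  obtain ⟨m', n', h'⟩ := h'
  refine ⟨m + m', n + n', fun k => ?_⟩
  have h1 := h (m' + k)
  have h2 := h' (n + k)
  rw [← add_assoc] at h1
  rw [h1, show n + (m' + k) = m' + (n + k) by omega, h2]
  congr 1
  omega

theorem TailEquiv.refl (x : E.InfPath) : x.TailEquiv x := ⟨0, 0, fun _ => rfl⟩

theorem tailEquiv_of_shift_eq {x y : E.InfPath} {m n : ℕ} (h : shift m x = shift n y) :
    x.TailEquiv y :=
  ⟨m, n, fun k => congrArg (fun z => z.edge k) h⟩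

end InfPath

namespace Cycle

variable {E : DirectedGraph.{u}} (c : E.Cycle)

theorem infty_edge (n : ℕ) :
    c.infty.edge n = c.edges[n % c.edges.length]'(Nat.mod_lt _ c.length_pos) := rfl

theorem infty_edge_of_lt {i : ℕ} (h : i < c.edges.length) : c.infty.edge i = c.edges[i] := by
  simp only [infty_edge, Nat.mod_eq_of_lt h]

theorem infty_edge_mem (n : ℕ) : c.infty.edge n ∈ c.edges := List.getElem_mem _

theorem infty_edge_zero : c.infty.edge 0 = c.first := by
  rw [infty_edge_of_lt c c.length_pos, first, List.head_eq_getElem]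

theorem source_infty : c.infty.source = c.source := by
  rw [InfPath.source, infty_edge_zero, source]

theorem shift_infty (n : ℕ) : InfPath.shift (n * c.edges.length) c.infty = c.infty := by
  ext k
  simp only [InfPath.shift, infty_edge, Nat.mul_add_mod_self_right]

theorem infty_edge_mul_add (n k : ℕ) :
    c.infty.edge (n * c.edges.length + k) = c.infty.edge k :=
  congrArg (fun z : E.InfPath => z.edge k) (shift_infty c n)

theorem take_eq_edges {x : E.InfPath} (h : c.Divides x) :
    InfPath.take c.edges.length x = c.edges := by
  refine List.ext_getElem (by simp [InfPath.take]) fun i h1 h2 => ?_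
  simp only [InfPath.take, List.getElem_map, List.getElem_range]
  exact h i h2

theorem divides_infty : c.Divides c.infty := fun _ h => infty_edge_of_lt c h

theorem edges_nodup : c.edges.Nodup := c.nodup.of_map

/-- An edge of a cycle is determined by its source. -/
theorem eq_of_s_eq {f g : E.Edge} (hf : f ∈ c.edges) (hg : g ∈ c.edges) (h : E.s f = E.s g) :
    f = g :=
  List.inj_on_of_nodup_map c.nodup hf hg h

/-- The infinite path `c^∞` has no period smaller than the length of `c`. -/
theorem dvd_of_infty_edge {d : ℕ} (h : c.infty.edge d = c.infty.edge 0) :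
    c.edges.length ∣ d := by
  simp only [infty_edge] at h
  have := (c.edges_nodup.getElem_inj_iff).mp h
  rw [Nat.zero_mod] at this
  exact Nat.dvd_of_mod_eq_zero this

theorem exists_shift_eq {x : E.InfPath} (h : x.TailEquiv c.infty) :
    ∃ m, InfPath.shift m x = c.infty := by
  obtain ⟨m, n, h⟩ := h
  have hpos := c.length_pos
  have hle : n ≤ n * c.edges.length := Nat.le_mul_of_pos_right n hpos
  -- Deleting `n * c.edges.length - n` further edges moves the offset `n` in `c^∞` up to a multiple
  -- of the period.
  refine ⟨m + (n * c.edges.length - n), ?_⟩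
  ext k
  have := h (n * c.edges.length - n + k)
  simp only [InfPath.shift]
  rw [add_assoc, this, show n + (n * c.edges.length - n + k) = n * c.edges.length + k by omega,
    infty_edge_mul_add]

theorem shift_add_length {x : E.InfPath} {m : ℕ} (h : InfPath.shift m x = c.infty) (k : ℕ) :
    InfPath.shift (m + k * c.edges.length) x = c.infty := by
  rw [← InfPath.shift_shift, h, shift_infty]

/-- Two ways of reaching `c^∞` along `x` differ by whole rounds through `c`, because the edges of
`c` are distinct. This is what makes the universal map below independent of a choice. -/
theorem exists_eq_add_of_shift_eq {x : E.InfPath} {m m' : ℕ} (hle : m ≤ m')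
    (h : InfPath.shift m x = c.infty) (h' : InfPath.shift m' x = c.infty) :
    ∃ k, m' = m + k * c.edges.length := by
  obtain ⟨d, rfl⟩ := Nat.exists_eq_add_of_le hle
  rw [← InfPath.shift_shift, h] at h'
  have h0 : c.infty.edge (d + 0) = c.infty.edge 0 := congrArg (fun z : E.InfPath => z.edge 0) h'
  obtain ⟨k, hk⟩ := c.dvd_of_infty_edge h0
  exact ⟨k, by rw [add_zero] at hk; rw [hk, mul_comm]⟩

/-- The path `c^∞` as an element of its tail equivalence class. -/
def basePath : c.TailClass := ⟨c.infty, InfPath.TailEquiv.refl _⟩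

end Cycle

/-! ### Generators of the unitization -/

section Unitization

variable {E : DirectedGraph.{u}} (K : Type v) [Field K]

/-- The Leavitt path algebra with an identity element adjoined. -/
abbrev ULPA (E : DirectedGraph.{u}) (K : Type v) [Field K] : Type (max u v) :=
  Unitization K (E.LPA K)

/-- The generators in the Leavitt path algebra with an identity element adjoined. -/
def ULPA.of (g : E.Gen) : E.ULPA K := ((LPA.of K g : E.LPA K) : Unitization K (E.LPA K))

open Classical in
theorem ULPA.isLeavittFamily_of : E.IsLeavittFamily (ULPA.of K : E.Gen → E.ULPA K) where
  vertex_mul_vertex v v' := by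
    simp only [ULPA.of, ← Unitization.inr_mul, LPA.isLeavittFamily_of.vertex_mul_vertex]
    split_ifs <;> rfl
  source_mul_edge f := by
    simp only [ULPA.of, ← Unitization.inr_mul, LPA.isLeavittFamily_of.source_mul_edge]
  edge_mul_range f := by
    simp only [ULPA.of, ← Unitization.inr_mul, LPA.isLeavittFamily_of.edge_mul_range]
  range_mul_ghost f := by
    simp only [ULPA.of, ← Unitization.inr_mul, LPA.isLeavittFamily_of.range_mul_ghost]
  ghost_mul_source f := by
    simp only [ULPA.of, ← Unitization.inr_mul, LPA.isLeavittFamily_of.ghost_mul_source]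
  ghost_mul_edge f f' := by
    simp only [ULPA.of, ← Unitization.inr_mul, LPA.isLeavittFamily_of.ghost_mul_edge]
    split_ifs <;> rfl
  sum_edge_mul_ghost v h hne := by
    simp only [ULPA.of, ← Unitization.inr_mul]
    rw [LPA.isLeavittFamily_of.sum_edge_mul_ghost v h hne]
    exact map_sum (Unitization.inrNonUnitalAlgHom K (E.LPA K)) _ _

variable {K}

/-- Induction on the elements of the Leavitt path algebra with an identity element adjoined. -/
theorem ULPA.induction {P : E.ULPA K → Prop} (scalar : ∀ k : K, P (algebraMap K _ k))
    (gen_mul : ∀ g a, P a → P (ULPA.of K g * a)) (add : ∀ a b, P a → P b → P (a + b))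
    (smul : ∀ (t : K) a, P a → P (t • a)) (a : E.ULPA K) : P a := by
  induction a using Unitization.ind with
  | inl_add_inr k a =>
    refine add _ _ (scalar k) ?_
    induction a using LPA.induction with
    | zero => simpa using scalar 0
    | gen g => simpa [ULPA.of] using gen_mul g 1 (by simpa using scalar 1)
    | gen_mul g x hx => simpa [ULPA.of] using gen_mul g _ hx
    | add x y hx hy => simpa using add _ _ hx hy
    | smul t x hx => simpa using smul t _ hx

/-- A `K`-linear map that commutes with the generators is linear over the unitization. -/
theorem map_smul_of_gen {M : Type*} {N : Type*} [AddCommGroup M] [AddCommGroup N]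
    [Module K M] [Module K N] [Module (E.ULPA K) M] [Module (E.ULPA K) N]
    [IsScalarTower K (E.ULPA K) M] [IsScalarTower K (E.ULPA K) N] (φ : M →ₗ[K] N)
    (h : ∀ (g : E.Gen) x, φ (ULPA.of K g • x) = ULPA.of K g • φ x) (a : E.ULPA K) (x : M) :
    φ (a • x) = a • φ x := by
  induction a using ULPA.induction with
  | scalar k => simp
  | gen_mul g a ha => rw [mul_smul, h, ha, mul_smul]
  | add a b ha hb => rw [add_smul, map_add, ha, hb, add_smul]
  | smul t a ha => rw [smul_assoc, map_smul, ha, smul_assoc]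

/-- The element of the Leavitt path algebra given by a list of edges. -/
def ULPA.path (K : Type v) [Field K] (l : List E.Edge) : E.ULPA K :=
  (l.map fun f => ULPA.of K (.edge f)).prod

@[simp] theorem ULPA.path_nil : ULPA.path K ([] : List E.Edge) = 1 := rfl

@[simp] theorem ULPA.path_cons (f : E.Edge) (l : List E.Edge) :
    ULPA.path K (f :: l) = ULPA.of K (.edge f) * ULPA.path K l := by
  simp [ULPA.path]

theorem ULPA.path_append (l l' : List E.Edge) :
    ULPA.path K (l ++ l') = ULPA.path K l * ULPA.path K l' := by
  simp [ULPA.path]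

theorem ULPA.vertex_mul_path {l : List E.Edge} (hl : l ≠ []) :
    ULPA.of K (.vertex (E.s (l.head hl))) * ULPA.path K l = ULPA.path K l := by
  cases l with
  | nil => exact absurd rfl hl
  | cons f l =>
    rw [ULPA.path_cons, ← mul_assoc, List.head_cons, (ULPA.isLeavittFamily_of K).source_mul_edge]

theorem ULPA.path_mul_vertex {l : List E.Edge} (hl : l ≠ []) :
    ULPA.path K l * ULPA.of K (.vertex (E.r (l.getLast hl))) = ULPA.path K l := by
  induction l with
  | nil => exact absurd rfl hl
  | cons f l ih =>
    rw [ULPA.path_cons, mul_assoc]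
    by_cases h : l = []
    · subst h
      simp [(ULPA.isLeavittFamily_of K).edge_mul_range]
    · rw [List.getLast_cons h, ih h]

end Unitization

/-! ### The element of a cycle -/

namespace Cycle

variable {E : DirectedGraph.{u}} (K : Type v) [Field K] (c : E.Cycle)

/-- The vertex at which a cycle is based, as an element of the algebra. -/
def vert : E.ULPA K := ULPA.of K (.vertex c.source)

/-- A cycle, as an element of the algebra. -/
def elt : E.ULPA K := ULPA.path K c.edges

/-- The value of a polynomial at a cycle, where the value of a constant `t` is `t` times the
vertex at which the cycle is based. -/
def polyElt (p : K[X]) : E.ULPA K := aeval (c.elt K) p * c.vert K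

open Classical in
theorem vert_mul_vert : c.vert K * c.vert K = c.vert K := by
  rw [vert, (ULPA.isLeavittFamily_of K).vertex_mul_vertex, if_pos rfl]

theorem vert_mul_elt : c.vert K * c.elt K = c.elt K := ULPA.vertex_mul_path c.ne_nil

theorem elt_mul_vert : c.elt K * c.vert K = c.elt K := by
  rw [vert, source, first, ← c.closed]
  exact ULPA.path_mul_vertex c.ne_nil

theorem vert_mul_aeval (p : K[X]) :
    c.vert K * aeval (c.elt K) p = aeval (c.elt K) p * c.vert K := by
  induction p using Polynomial.induction_on' with
  | add p q hp hq => rw [map_add, mul_add, add_mul, hp, hq]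
  | monomial n t =>
    rw [aeval_monomial, ← Algebra.smul_def, mul_smul_comm, smul_mul_assoc]
    congr 1
    have h : Commute (c.vert K) (c.elt K) := (c.vert_mul_elt K).trans (c.elt_mul_vert K).symm
    exact h.pow_right n

theorem vert_mul_polyElt (p : K[X]) : c.vert K * c.polyElt K p = c.polyElt K p := by
  rw [polyElt, ← mul_assoc, vert_mul_aeval, mul_assoc, vert_mul_vert]

theorem polyElt_mul_vert (p : K[X]) : c.polyElt K p * c.vert K = c.polyElt K p := by
  rw [polyElt, mul_assoc, vert_mul_vert]

end Cycle

end DirectedGraph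

namespace DirectedGraph

/-! ### The action of the generators on `V^p_{[c^∞]}` -/

section Twisted

variable {E : DirectedGraph.{u}} {K : Type v} [Field K] (c : E.Cycle) {p : K[X]}
  (hp : IsBasicIrreducible p)

instance : Module K (TwistedSpace c p hp) :=
  inferInstanceAs (Module K (c.TailClass →₀ AdjoinRoot p))

instance : IsScalarTower K (E.ULPA K) (TwistedSpace c p hp) where
  smul_assoc k a x := by
    change (Unitization.lift (twistedRep c p hp) (k • a) :
      Module.End (AdjoinRoot p) (c.TailClass →₀ AdjoinRoot p)) x =
        k • (Unitization.lift (twistedRep c p hp) a :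
          Module.End (AdjoinRoot p) (c.TailClass →₀ AdjoinRoot p)) x
    rw [map_smul]
    rfl

/-- The basis vector of `V^p_{[c^∞]}` at an infinite path, with a coefficient. -/
def TwistedSpace.single (x : c.TailClass) (t : AdjoinRoot p) : TwistedSpace c p hp :=
  (Finsupp.single x t : c.TailClass →₀ AdjoinRoot p)

open Classical in
/-- The scalar by which the action of an edge is twisted. -/
def weight (f : E.Edge) : (AdjoinRoot p)ˣ := if f = c.first then hp.isUnit_root.unit else 1

/-- The product of the scalars of the edges in a list. -/
def pathWeight (l : List E.Edge) : (AdjoinRoot p)ˣ := (l.map (weight c hp)).prod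

variable {c hp}

@[simp] theorem pathWeight_nil : pathWeight c hp [] = 1 := rfl

@[simp] theorem pathWeight_cons (f : E.Edge) (l : List E.Edge) :
    pathWeight c hp (f :: l) = weight c hp f * pathWeight c hp l := by
  simp [pathWeight]

theorem pathWeight_append (l l' : List E.Edge) :
    pathWeight c hp (l ++ l') = pathWeight c hp l * pathWeight c hp l' := by
  simp [pathWeight]

namespace TwistedSpace

theorem single_add (x : c.TailClass) (t t' : AdjoinRoot p) :
    single c hp x (t + t') = single c hp x t + single c hp x t' :=
  Finsupp.single_add x t t'

theorem smul_single (k : K) (x : c.TailClass) (t : AdjoinRoot p) :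
    k • single c hp x t = single c hp x (k • t) :=
  Finsupp.smul_single k x t

theorem single_zero (x : c.TailClass) : single c hp x 0 = 0 := Finsupp.single_zero x

@[elab_as_elim]
theorem induction {P : TwistedSpace c p hp → Prop} (zero : P 0)
    (add : ∀ x y, P x → P y → P (x + y)) (single : ∀ x t, P (single c hp x t))
    (y : TwistedSpace c p hp) : P y :=
  Finsupp.induction_linear (motive := fun z : c.TailClass →₀ AdjoinRoot p => P z) y zero
    (fun _ _ => add _ _) single

theorem of_smul (g : E.Gen) (x : TwistedSpace c p hp) :
    ULPA.of K g • x =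
      (chenRep (AdjoinRoot p) c (LPA.gaugeFun c.first hp.isUnit_root.unit g) :
        Module.End (AdjoinRoot p) (c.TailClass →₀ AdjoinRoot p)) x := by
  rw [ULPA.of, TwistedSpace.smul_def, twistedRep_of]

theorem vertex_smul_single (a : E.Vertex) (x : c.TailClass) (t : AdjoinRoot p)
    [Decidable (a = x.1.source)] :
    ULPA.of K (.vertex a) • single c hp x t = if a = x.1.source then single c hp x t else 0 := by
  rw [of_smul, LPA.gaugeFun, chenRep, LPA.lift_of]
  exact chenFun_vertex_single _ _ _ _ _

theorem edge_smul_single (f : E.Edge) (x : c.TailClass) (t : AdjoinRoot p)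
    [Decidable (E.r f = x.1.source)] :
    ULPA.of K (.edge f) • single c hp x t =
      if h : E.r f = x.1.source then
        single c hp ⟨x.1.cons f h, InfPath.tailEquiv_cons x.2 f h⟩ (weight c hp f * t) else 0 := by
  rw [of_smul, LPA.gaugeFun, chenRep, weight]
  by_cases hf : f = c.first
  · subst hf
    simp only [if_true, map_smul, LPA.lift_of]
    refine (congrArg (fun y : c.TailClass →₀ AdjoinRoot p => (_ : AdjoinRoot p) • y)
      (chenFun_edge_single _ c _ x t)).trans ?_
    split_ifs
    · exact Finsupp.smul_single _ _ _
    · exact smul_zero _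
  · simp only [hf, if_false, LPA.lift_of, Units.val_one, one_mul]
    exact chenFun_edge_single _ _ _ _ _

theorem ghost_smul_single (f : E.Edge) (x : c.TailClass) (t : AdjoinRoot p)
    [Decidable (f = x.1.edge 0)] :
    ULPA.of K (.ghost f) • single c hp x t =
      if f = x.1.edge 0 then
        single c hp ⟨x.1.tail, InfPath.tailEquiv_tail x.2⟩
          (((weight c hp f)⁻¹ : (AdjoinRoot p)ˣ) * t) else 0 := by
  rw [of_smul, LPA.gaugeFun, chenRep, weight]
  by_cases hf : f = c.first
  · subst hf
    simp only [if_true, map_smul, LPA.lift_of]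
    refine (congrArg (fun y : c.TailClass →₀ AdjoinRoot p => (_ : AdjoinRoot p) • y)
      (chenFun_ghost_single _ c _ x t)).trans ?_
    split_ifs
    · exact Finsupp.smul_single _ _ _
    · exact smul_zero _
  · simp only [hf, if_false, LPA.lift_of, inv_one, Units.val_one, one_mul]
    exact chenFun_ghost_single _ _ _ _ _

/-- Concatenation with a finite path. -/
theorem path_smul_single (m : ℕ) {x : c.TailClass} {y : c.TailClass}
    (h : InfPath.shift m x.1 = y.1) (t : AdjoinRoot p) :
    ULPA.path K (InfPath.take m x.1) • single c hp y t =
      single c hp x (pathWeight c hp (InfPath.take m x.1) * t) := by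
  classical
  induction m generalizing x with
  | zero =>
    obtain rfl : x = y := Subtype.ext (by simpa using h)
    simp
  | succ m ih =>
    rw [← InfPath.shift_tail] at h
    have := ih (x := ⟨x.1.tail, InfPath.tailEquiv_tail x.2⟩) h
    rw [InfPath.take_succ, ULPA.path_cons, mul_smul, this, edge_smul_single,
      dif_pos x.1.source_tail.symm]
    simp only [InfPath.cons_tail, pathWeight_cons, Units.val_mul, mul_assoc]

/-- Concatenation with the cycle `d`. -/
theorem elt_smul_single (d : E.Cycle) {x y : c.TailClass} (hx : d.Divides x.1)
    (h : InfPath.shift d.edges.length x.1 = y.1) (t : AdjoinRoot p) :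
    d.elt K • single c hp y t = single c hp x (pathWeight c hp d.edges * t) := by
  rw [Cycle.elt, ← d.take_eq_edges hx, path_smul_single _ h]

end TwistedSpace

/-- The weights commute, so the base point of the cycle is irrelevant. Only the first edge of `c`
carries a non-trivial weight, and it occurs exactly once. -/
theorem pathWeight_eq_root {d : E.Cycle} (h : d.IsRotation c) :
    (pathWeight c hp d.edges : AdjoinRoot p) = AdjoinRoot.root p := by
  classical
  rw [pathWeight, (h.perm.map _).prod_eq]
  have h1 : c.edges = c.first :: c.edges.tail := (List.cons_head_tail c.ne_nil).symm
  have h2 := c.edges_nodup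
  rw [h1, List.nodup_cons] at h2
  rw [h1, List.map_cons, List.prod_cons, List.prod_eq_one]
  · rw [mul_one, weight, if_pos rfl]
    rfl
  · intro a ha
    obtain ⟨f, hf, rfl⟩ := List.mem_map.mp ha
    rw [weight, if_neg]
    rintro rfl
    exact h2.1 hf

theorem pathWeight_eq_one {d : E.Cycle} (h : c.first ∉ d.edges) :
    pathWeight c hp d.edges = 1 := by
  rw [pathWeight, List.prod_eq_one]
  intro a ha
  obtain ⟨f, hf, rfl⟩ := List.mem_map.mp ha
  rw [weight, if_neg]
  rintro rfl
  exact h hf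

/-- This links the twist to the polynomial: `c` acts on the line of `c^∞` as the class of `x`, hence
`f(c)` acts as the class of `f`, and `p(c)` as zero. -/
theorem elt_smul_base (t : AdjoinRoot p) :
    c.elt K • TwistedSpace.single c hp c.basePath t =
      TwistedSpace.single c hp c.basePath (AdjoinRoot.root p * t) := by
  have h : InfPath.shift c.edges.length c.infty = c.infty := by
    simpa using c.shift_infty 1
  have h1 := TwistedSpace.elt_smul_single (hp := hp) c (x := c.basePath) (y := c.basePath)
    c.divides_infty h t
  rwa [pathWeight_eq_root (List.IsRotated.refl _)] at h1

theorem aeval_smul_base (f : K[X]) :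
    aeval (c.elt K) f • TwistedSpace.single c hp c.basePath 1 =
      TwistedSpace.single c hp c.basePath (AdjoinRoot.mk p f) := by
  induction f using Polynomial.induction_on with
  | C a =>
    rw [aeval_C, algebraMap_smul, TwistedSpace.smul_single, Algebra.smul_def, mul_one]
    rfl
  | add f g hf hg => rw [map_add, add_smul, hf, hg, map_add, TwistedSpace.single_add]
  | monomial n a ih =>
    have h : (C a * X ^ (n + 1) : K[X]) = X * (C a * X ^ n) := by ring
    rw [h, map_mul, aeval_X, mul_smul, ih, elt_smul_base, map_mul (AdjoinRoot.mk p) X,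
      AdjoinRoot.mk_X]

theorem vert_smul_base (t : AdjoinRoot p) :
    c.vert K • TwistedSpace.single c hp c.basePath t = TwistedSpace.single c hp c.basePath t := by
  classical
  rw [Cycle.vert, TwistedSpace.vertex_smul_single]
  exact if_pos c.source_infty.symm

/-- The module `V^p_{[c^∞]}` is generated by `c^∞`. -/
theorem exists_smul_base (y : TwistedSpace c p hp) :
    ∃ a : E.ULPA K, a • TwistedSpace.single c hp c.basePath 1 = y := by
  induction y using TwistedSpace.induction with
  | zero => exact ⟨0, zero_smul _ _⟩
  | add x y hx hy =>
    obtain ⟨a, rfl⟩ := hx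
    obtain ⟨b, rfl⟩ := hy
    exact ⟨a + b, add_smul _ _ _⟩
  | single x t =>
    obtain ⟨m, hm⟩ := c.exists_shift_eq x.2
    -- Concatenation with the initial segment of `x` multiplies by its weight, so this weight is
    -- divided out beforehand.
    obtain ⟨f, hf⟩ := AdjoinRoot.mk_surjective
      ((((pathWeight c hp (InfPath.take m x.1))⁻¹ : (AdjoinRoot p)ˣ) : AdjoinRoot p) * t)
    refine ⟨ULPA.path K (InfPath.take m x.1) * aeval (c.elt K) f, ?_⟩
    rw [mul_smul, aeval_smul_base, TwistedSpace.path_smul_single m (y := c.basePath) hm, hf,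
      Units.mul_inv_cancel_left]

end Twisted

/-! ### The universal property of `V^p_{[c^∞]}` -/

section Universal

variable {E : DirectedGraph.{u}} {K : Type v} [Field K] {c : E.Cycle} {p : K[X]}
  (hp : IsBasicIrreducible p) {W : Type*} [AddCommGroup W] [Module K W] [Module (E.ULPA K) W]
  [IsScalarTower K (E.ULPA K) W] {w : W}

/-- The map `f ↦ f(c) w` on polynomials modulo `p`, where `p(c) w = 0`. -/
def evalAt (hw : aeval (c.elt K) p • w = 0) : AdjoinRoot p →ₗ[K] W where
  toFun := Quotient.lift (s := Submodule.quotientRel (Ideal.span {p}))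
    (fun f => aeval (c.elt K) f • w) (by
      intro f g hfg
      obtain ⟨h, hh⟩ := Ideal.mem_span_singleton.mp ((Submodule.quotientRel_def _).mp hfg)
      rw [← sub_eq_zero, ← sub_smul, ← map_sub, hh, mul_comm, map_mul, mul_smul, hw, smul_zero])
  map_add' x y := by
    induction x using AdjoinRoot.induction_on with
    | ih f =>
      induction y using AdjoinRoot.induction_on with
      | ih g =>
        change aeval (c.elt K) (f + g) • w = aeval (c.elt K) f • w + aeval (c.elt K) g • w
        rw [map_add, add_smul]
  map_smul' k x := by
    induction x using AdjoinRoot.induction_on with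
    | ih f =>
      change aeval (c.elt K) (k • f) • w = k • aeval (c.elt K) f • w
      rw [map_smul, smul_assoc]

theorem evalAt_mk (hw : aeval (c.elt K) p • w = 0) (f : K[X]) :
    evalAt hw (AdjoinRoot.mk p f) = aeval (c.elt K) f • w := rfl

theorem elt_smul_evalAt (hw : aeval (c.elt K) p • w = 0) (t : AdjoinRoot p) :
    c.elt K • evalAt hw t = evalAt hw (AdjoinRoot.root p * t) := by
  induction t using AdjoinRoot.induction_on with
  | ih f =>
    rw [← AdjoinRoot.mk_X, ← map_mul, evalAt_mk, evalAt_mk, map_mul, aeval_X, mul_smul]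

theorem vert_smul_evalAt (hw : aeval (c.elt K) p • w = 0) (hv : c.vert K • w = w)
    (t : AdjoinRoot p) : c.vert K • evalAt hw t = evalAt hw t := by
  induction t using AdjoinRoot.induction_on with
  | ih f =>
    rw [evalAt_mk, ← mul_smul, Cycle.vert_mul_aeval, mul_smul, hv]

/-- The value of the universal map at a multiple of a path that reaches `c^∞` after `m` edges. -/
def universalAux (hw : aeval (c.elt K) p • w = 0) (m : ℕ) (x : E.InfPath) : AdjoinRoot p →ₗ[K] W :=
  (Algebra.lsmul K K W (ULPA.path K (InfPath.take m x))).comp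
    ((evalAt hw).comp (LinearMap.mulLeft K
      (((pathWeight c hp (InfPath.take m x))⁻¹ : (AdjoinRoot p)ˣ) : AdjoinRoot p)))

theorem universalAux_apply (hw : aeval (c.elt K) p • w = 0) (m : ℕ) (x : E.InfPath)
    (t : AdjoinRoot p) : universalAux hp hw m x t = ULPA.path K (InfPath.take m x) •
      evalAt hw (((pathWeight c hp (InfPath.take m x))⁻¹ : (AdjoinRoot p)ˣ) * t) := rfl

theorem universalAux_add (hw : aeval (c.elt K) p • w = 0) (m k : ℕ) (x : E.InfPath)
    (t : AdjoinRoot p) : universalAux hp hw (m + k) x t = ULPA.path K (InfPath.take m x) •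
      universalAux hp hw k (InfPath.shift m x)
        (((pathWeight c hp (InfPath.take m x))⁻¹ : (AdjoinRoot p)ˣ) * t) := by
  simp only [universalAux_apply, InfPath.take_add, ULPA.path_append, pathWeight_append, mul_smul,
    mul_inv_rev, Units.val_mul, mul_assoc]

theorem universalAux_zero (hw : aeval (c.elt K) p • w = 0) (x : E.InfPath) (t : AdjoinRoot p) :
    universalAux hp hw 0 x t = evalAt hw t := by
  simp [universalAux_apply]

theorem universalAux_succ (hw : aeval (c.elt K) p • w = 0) (m : ℕ) (x : E.InfPath)
    (t : AdjoinRoot p) : universalAux hp hw (m + 1) x t = ULPA.of K (.edge (x.edge 0)) •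
      universalAux hp hw m x.tail (((weight c hp (x.edge 0))⁻¹ : (AdjoinRoot p)ˣ) * t) := by
  rw [add_comm, universalAux_add]
  have h : InfPath.shift 1 x = x.tail := by rw [← InfPath.shift_tail, InfPath.shift_zero]
  rw [h, InfPath.take_succ]
  simp

/-- A round through `c` divides the coefficient by the class of `x` and then lets `c` act, which
multiplies by that class again. The two effects cancel, so superfluous rounds do not change the
value. -/
theorem universalAux_infty (hw : aeval (c.elt K) p • w = 0) (k : ℕ) (t : AdjoinRoot p) :
    universalAux hp hw (k * c.edges.length) c.infty t = evalAt hw t := by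
  induction k generalizing t with
  | zero => rw [zero_mul, universalAux_zero]
  | succ k ih =>
    rw [show (k + 1) * c.edges.length = c.edges.length + k * c.edges.length by ring,
      universalAux_add, show InfPath.shift c.edges.length c.infty = c.infty by
        simpa using c.shift_infty 1, ih, c.take_eq_edges c.divides_infty]
    change c.elt K • _ = _
    rw [elt_smul_evalAt, ← pathWeight_eq_root (hp := hp) (List.IsRotated.refl c.edges),
      Units.mul_inv_cancel_left]

theorem universalAux_congr (hw : aeval (c.elt K) p • w = 0) {m m' : ℕ} {x : E.InfPath}
    (h : InfPath.shift m x = c.infty) (h' : InfPath.shift m' x = c.infty) (t : AdjoinRoot p) :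
    universalAux hp hw m x t = universalAux hp hw m' x t := by
  wlog hle : m ≤ m' generalizing m m'
  · exact (this h' h (by omega)).symm
  obtain ⟨k, rfl⟩ := c.exists_eq_add_of_shift_eq hle h h'
  rw [universalAux_add, h, universalAux_infty, universalAux_apply]

theorem source_smul_universalAux (hw : aeval (c.elt K) p • w = 0) (hv : c.vert K • w = w) {m : ℕ}
    {x : E.InfPath} (h : InfPath.shift m x = c.infty) (t : AdjoinRoot p) :
    ULPA.of K (.vertex x.source) • universalAux hp hw m x t = universalAux hp hw m x t := by
  cases m with
  | zero =>
    rw [InfPath.shift_zero] at h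
    subst h
    rw [universalAux_zero, Cycle.source_infty]
    exact vert_smul_evalAt hw hv t
  | succ m =>
    rw [universalAux_succ, InfPath.source, ← mul_smul,
      (ULPA.isLeavittFamily_of K).source_mul_edge]

/-- The `K`-linear map that underlies the universal map. -/
def universalLin (hw : aeval (c.elt K) p • w = 0) : TwistedSpace c p hp →ₗ[K] W :=
  (Finsupp.lsum K fun x : c.TailClass =>
    universalAux hp hw (c.exists_shift_eq x.2).choose x.1 :
      (c.TailClass →₀ AdjoinRoot p) →ₗ[K] W)

theorem universalLin_single (hw : aeval (c.elt K) p • w = 0) (x : c.TailClass) {m : ℕ}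
    (h : InfPath.shift m x.1 = c.infty) (t : AdjoinRoot p) :
    universalLin hp hw (TwistedSpace.single c hp x t) = universalAux hp hw m x.1 t := by
  rw [universalAux_congr hp hw h (c.exists_shift_eq x.2).choose_spec]
  exact Finsupp.lsum_single (σ := RingHom.id K) K
    (fun x : c.TailClass => universalAux hp hw (c.exists_shift_eq x.2).choose x.1) x t

theorem universalLin_base (hw : aeval (c.elt K) p • w = 0) :
    universalLin hp hw (TwistedSpace.single c hp c.basePath 1) = w := by
  rw [universalLin_single hp hw c.basePath (m := 0) (InfPath.shift_zero _), universalAux_zero,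
    ← map_one (AdjoinRoot.mk p), evalAt_mk, map_one, one_smul]

/-- An edge lengthens the initial segment by one and a ghost edge shortens it by one. Where a
generator kills the basis vector, it also kills the image: the image is fixed by the vertex at the
source of the path, and distinct vertices are orthogonal, or the ghost edge meets a different first
edge. -/
theorem universalLin_gen_smul (hw : aeval (c.elt K) p • w = 0) (hv : c.vert K • w = w)
    (g : E.Gen) (y : TwistedSpace c p hp) :
    universalLin hp hw (ULPA.of K g • y) = ULPA.of K g • universalLin hp hw y := by
  classical
  have fam := ULPA.isLeavittFamily_of K (E := E)
  induction y using TwistedSpace.induction with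
  | zero => simp
  | add x y hx hy => rw [smul_add, map_add, hx, hy, map_add, smul_add]
  | single x t =>
    obtain ⟨m, hm⟩ := c.exists_shift_eq x.2
    cases g with
    | vertex a =>
      rw [TwistedSpace.vertex_smul_single]
      split_ifs with ha
      · rw [universalLin_single hp hw x hm, ha, source_smul_universalAux hp hw hv hm]
      · rw [universalLin_single hp hw x hm, ← source_smul_universalAux hp hw hv hm, ← mul_smul,
          fam.vertex_mul_vertex, if_neg ha, zero_smul, map_zero]
    | edge f =>
      rw [TwistedSpace.edge_smul_single, universalLin_single hp hw x hm]
      split_ifs with ha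
      · rw [universalLin_single hp hw _ (m := m + 1) (by
          rw [← InfPath.shift_tail, InfPath.tail_cons, hm]), universalAux_succ]
        simp only [InfPath.edge_zero_cons, InfPath.tail_cons, Units.inv_mul_cancel_left]
      · rw [← source_smul_universalAux hp hw hv hm, ← mul_smul, ← fam.edge_mul_range, mul_assoc,
          fam.vertex_mul_vertex, if_neg ha, mul_zero, zero_smul, map_zero]
    | ghost f =>
      have hpos := c.length_pos
      -- The initial segment may be empty, and then there is no edge for the ghost edge to cancel;
      -- one extra round through `c` provides one.
      obtain ⟨n, hn⟩ : ∃ n, m + 1 * c.edges.length = n + 1 := ⟨m + c.edges.length - 1, by omega⟩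
      have hm' : InfPath.shift (n + 1) x.1 = c.infty := by rw [← hn]; exact c.shift_add_length hm 1
      have ht : InfPath.shift n x.1.tail = c.infty := by rw [InfPath.shift_tail, hm']
      rw [TwistedSpace.ghost_smul_single, universalLin_single hp hw x hm', universalAux_succ,
        ← mul_smul, fam.ghost_mul_edge]
      split_ifs with ha
      · rw [universalLin_single hp hw _ ht, ← ha, ha, ← InfPath.source_tail,
          source_smul_universalAux hp hw hv ht]
      · rw [map_zero, zero_smul]

/-- The annihilator of `c^∞` in `L v` is generated by `p(c)`. -/
theorem exists_mul_polyElt {a : E.ULPA K} (ha : a * c.vert K = a)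
    (h : a • TwistedSpace.single c hp c.basePath 1 = 0) : ∃ b, a = b * c.polyElt K p := by
  -- In the quotient by `L p(c)` the class of `v` satisfies the relations required of an image of
  -- `c^∞`. The resulting module map sends `a c^∞ = 0` to the class of `a v = a`, so `a` lies in `L
  -- p(c)`.
  let I : Submodule (E.ULPA K) (E.ULPA K) := Submodule.span _ {c.polyElt K p}
  have hw : aeval (c.elt K) p • I.mkQ (c.vert K) = 0 := by
    rw [← map_smul, Submodule.mkQ_apply, Submodule.Quotient.mk_eq_zero]
    exact Submodule.mem_span_singleton_self _
  have hv : c.vert K • I.mkQ (c.vert K) = I.mkQ (c.vert K) := by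
    rw [← map_smul, smul_eq_mul, Cycle.vert_mul_vert]
  have h1 := map_smul_of_gen (universalLin hp hw) (universalLin_gen_smul hp hw hv) a
    (TwistedSpace.single c hp c.basePath 1)
  rw [h, map_zero, universalLin_base, ← map_smul, smul_eq_mul, ha, eq_comm, Submodule.mkQ_apply,
    Submodule.Quotient.mk_eq_zero, Submodule.mem_span_singleton] at h1
  obtain ⟨b, hb⟩ := h1
  exact ⟨b, hb.symm⟩

theorem polyElt_smul_base :
    c.polyElt K p • TwistedSpace.single c hp c.basePath 1 = 0 := by
  rw [Cycle.polyElt, mul_smul, vert_smul_base, aeval_smul_base, AdjoinRoot.mk_self,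
    TwistedSpace.single_zero]

end Universal

end DirectedGraph

namespace DirectedGraph

/-! ### The grading and cancellation of `p(c)` -/

section Grading

variable {E : DirectedGraph.{u}} (K : Type v) [Field K]

/-- The degree of a generator. -/
def Gen.degree : E.Gen → ℤ
  | .vertex _ => 0
  | .edge _ => 1
  | .ghost _ => -1

/-- The generators as homogeneous Laurent polynomials. -/
def gradingFun (g : E.Gen) : AddMonoidAlgebra (E.ULPA K) ℤ :=
  AddMonoidAlgebra.single g.degree (ULPA.of K g)

open Classical in
theorem isLeavittFamily_gradingFun : E.IsLeavittFamily (gradingFun K : E.Gen → _) where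
  vertex_mul_vertex v v' := by
    simp only [gradingFun, AddMonoidAlgebra.single_mul_single, Gen.degree,
      (ULPA.isLeavittFamily_of K).vertex_mul_vertex, add_zero]
    split_ifs <;> simp
  source_mul_edge f := by
    simp only [gradingFun, AddMonoidAlgebra.single_mul_single, Gen.degree, zero_add,
      (ULPA.isLeavittFamily_of K).source_mul_edge]
  edge_mul_range f := by
    simp only [gradingFun, AddMonoidAlgebra.single_mul_single, Gen.degree, add_zero,
      (ULPA.isLeavittFamily_of K).edge_mul_range]
  range_mul_ghost f := by
    simp only [gradingFun, AddMonoidAlgebra.single_mul_single, Gen.degree, zero_add,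
      (ULPA.isLeavittFamily_of K).range_mul_ghost]
  ghost_mul_source f := by
    simp only [gradingFun, AddMonoidAlgebra.single_mul_single, Gen.degree, add_zero,
      (ULPA.isLeavittFamily_of K).ghost_mul_source]
  ghost_mul_edge f f' := by
    simp only [gradingFun, AddMonoidAlgebra.single_mul_single, Gen.degree,
      (ULPA.isLeavittFamily_of K).ghost_mul_edge, neg_add_cancel]
    split_ifs <;> simp
  sum_edge_mul_ghost v h hne := by
    simp only [gradingFun, AddMonoidAlgebra.single_mul_single, Gen.degree, add_neg_cancel]
    rw [(ULPA.isLeavittFamily_of K).sum_edge_mul_ghost v h hne]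
    exact map_sum (AddMonoidAlgebra.singleAddHom (0 : ℤ)) _ _

/-- The grading of the algebra by the length of paths, as a homomorphism to Laurent polynomials. -/
def grading : E.ULPA K →ₐ[K] AddMonoidAlgebra (E.ULPA K) ℤ :=
  Unitization.lift (LPA.lift (gradingFun K) (isLeavittFamily_gradingFun K))

variable {K}

theorem grading_of (g : E.Gen) :
    grading K (ULPA.of K g) = AddMonoidAlgebra.single g.degree (ULPA.of K g) := by
  have h : grading K (ULPA.of K g) =
      LPA.lift (gradingFun K) (isLeavittFamily_gradingFun K) (LPA.of K g) := by
    simp [grading, ULPA.of]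
  rw [h, LPA.lift_of, gradingFun]

theorem grading_path (l : List E.Edge) :
    grading K (ULPA.path K l) = AddMonoidAlgebra.single (l.length : ℤ) (ULPA.path K l) := by
  induction l with
  | nil => rw [ULPA.path_nil, map_one]; rfl
  | cons f l ih =>
    rw [ULPA.path_cons, map_mul, ih, grading_of, AddMonoidAlgebra.single_mul_single, Gen.degree,
      List.length_cons, Nat.cast_add, Nat.cast_one, add_comm]

/-- Setting the Laurent variable equal to `1` is a left inverse. -/
theorem grading_injective : Function.Injective (grading K : E.ULPA K →ₐ[K] _) := by
  let aug : AddMonoidAlgebra (E.ULPA K) ℤ →+* E.ULPA K :=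
    AddMonoidAlgebra.liftNCRingHom (RingHom.id _) (1 : Multiplicative ℤ →* E.ULPA K)
      fun _ _ => Commute.one_right _
  have haug : ∀ (n : ℤ) a, aug (AddMonoidAlgebra.single n a) = a := fun n a => by
    refine (AddMonoidAlgebra.liftNC_single _ _ _ _).trans ?_
    simp
  refine Function.LeftInverse.injective (g := aug) fun a => ?_
  induction a using ULPA.induction with
  | scalar k =>
    rw [AlgHom.commutes]
    exact haug 0 _
  | gen_mul g a ha => rw [map_mul, map_mul, ha, grading_of, haug]
  | add a b ha hb => rw [map_add, map_add, ha, hb]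
  | smul t a ha =>
    rw [Algebra.smul_def, map_mul, map_mul, ha, AlgHom.commutes]
    exact congrArg (· * a) (haug 0 _)

/-- All exponents of the Laurent polynomial `x` are at least `N`. -/
def OrderGE (N : ℤ) (x : AddMonoidAlgebra (E.ULPA K) ℤ) : Prop := ∀ d < N, x.coeff d = 0

theorem OrderGE.mul_single {N : ℤ} {x : AddMonoidAlgebra (E.ULPA K) ℤ} (h : OrderGE N x) (n : ℤ)
    (a : E.ULPA K) : OrderGE (N + n) (x * AddMonoidAlgebra.single n a) := fun d hd => by
  rw [AddMonoidAlgebra.coeff_mul_single_apply, h _ (by omega), zero_mul]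

/-- A polynomial in a homogeneous element of degree `n ≥ 0` has no negative exponents, so
multiplying by it cannot lower the order. -/
theorem OrderGE.mul_aeval {N : ℤ} {x : AddMonoidAlgebra (E.ULPA K) ℤ} (h : OrderGE N x) (n : ℕ)
    (a : E.ULPA K) (r : K[X]) :
    OrderGE N (x * aeval (AddMonoidAlgebra.single (n : ℤ) a : AddMonoidAlgebra (E.ULPA K) ℤ) r) := by
  induction r using Polynomial.induction_on' with
  | add r s hr hs =>
    intro d hd
    rw [map_add, mul_add, AddMonoidAlgebra.coeff_add, Finsupp.add_apply, hr d hd, hs d hd,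
      add_zero]
  | monomial k t =>
    have hk : OrderGE N (x * AddMonoidAlgebra.single (n : ℤ) a ^ k) := by
      induction k with
      | zero => simpa using h
      | succ k ih =>
        intro d hd
        rw [pow_succ, ← mul_assoc]
        exact ih.mul_single n a d (by omega)
    intro d hd
    rw [aeval_monomial, ← Algebra.smul_def, mul_smul_comm, AddMonoidAlgebra.coeff_smul,
      Finsupp.smul_apply, hk d hd, smul_zero]

theorem exists_orderGE (x : AddMonoidAlgebra (E.ULPA K) ℤ) : ∃ N, OrderGE N x := by
  obtain ⟨N, hN⟩ := x.coeff.support.bddBelow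
  refine ⟨N, fun d hd => ?_⟩
  by_contra h
  exact absurd (hN (Finsupp.mem_support_iff.mpr h)) (by omega)

/-- Right multiplication by `p(c)` is injective on `L v`, where `v` is the source of `c`. -/
theorem eq_zero_of_mul_polyElt {c : E.Cycle} {p : K[X]} (hp : p.coeff 0 = -1) {a : E.ULPA K}
    (ha : a * c.vert K = a) (h : a * c.polyElt K p = 0) : a = 0 := by
  have h1 : a * aeval (c.elt K) p = 0 := by
    rw [← ha, mul_assoc, Cycle.vert_mul_aeval]
    exact h
  -- Here `p = X * p.divX - 1`, by the normalization of the constant term.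
  have h2 : a * c.elt K * aeval (c.elt K) p.divX = a := by
    rw [← Polynomial.divX_mul_X_add p, hp, mul_comm, map_add, map_mul, aeval_X, map_neg, map_one,
      map_neg, map_one, mul_add, mul_neg, mul_one, add_neg_eq_zero, ← mul_assoc] at h1
    exact h1
  have h3 := congrArg (grading K) h2
  have hγ : grading K (c.elt K) = AddMonoidAlgebra.single (c.edges.length : ℤ) (c.elt K) :=
    grading_path _
  rw [map_mul, map_mul, ← Polynomial.aeval_algHom_apply, hγ] at h3
  -- The left side of `h3` has order larger by at least the length of `c`, yet it equals the grading
  -- of `a`. So every lower bound for the exponents improves without limit, and no exponent remains.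
  have step : ∀ k : ℕ, ∀ N, OrderGE N (grading K a) → OrderGE (N + k) (grading K a) := by
    intro k
    induction k with
    | zero => intro N hN; simpa using hN
    | succ k ih =>
      intro N hN d hd
      have hpos := c.length_pos
      have h4 := ((ih N hN).mul_single c.edges.length (c.elt K)).mul_aeval c.edges.length
        (c.elt K) p.divX
      rw [h3] at h4
      exact h4 d (by push_cast at hd; omega)
  refine grading_injective ?_
  rw [map_zero]
  obtain ⟨N, hN⟩ := exists_orderGE (grading K a)
  refine LaurentPolynomial.ext fun d => ?_
  exact step (d - N + 1).toNat N hN d (by omega)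

end Grading

end DirectedGraph

namespace DirectedGraph

/-! ### The projective resolution of `V^p_{[c^∞]}` -/

section Resolution

variable {E : DirectedGraph.{u}} {K : Type v} [Field K] (c : E.Cycle)

variable (K) in
/-- The left ideal `L v`, where `v` is the source of the cycle `c`. -/
def leftIdeal : Submodule (E.ULPA K) (E.ULPA K) := Submodule.span _ {c.vert K}

variable {c} in
theorem mem_leftIdeal {a : E.ULPA K} : a ∈ leftIdeal K c ↔ a * c.vert K = a := by
  rw [leftIdeal, Submodule.mem_span_singleton]
  constructor
  · rintro ⟨b, rfl⟩
    rw [smul_eq_mul, mul_assoc, Cycle.vert_mul_vert]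
  · exact fun h => ⟨a, h⟩

variable (K) in
/-- The generator of `L v`. -/
def leftIdealGen : leftIdeal K c := ⟨c.vert K, mem_leftIdeal.mpr (c.vert_mul_vert K)⟩

variable {c} in
theorem smul_leftIdealGen (a : leftIdeal K c) : (a : E.ULPA K) • leftIdealGen K c = a :=
  Subtype.ext (mem_leftIdeal.mp a.2)

theorem isUnital_leftIdeal : E.isUnital K (ModuleCat.of (E.ULPA K) (leftIdeal K c)) := by
  rw [isUnital_iff]
  rintro ⟨a, ha⟩
  -- The Leavitt path algebra is an ideal of its unitization and contains `v`, so `a = a v` lies in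
  -- it and has a local unit.
  obtain ⟨b, hb⟩ : ∃ b : E.LPA K, a = (b : Unitization K (E.LPA K)) := by
    rw [mem_leftIdeal] at ha
    rw [← ha, Cycle.vert, ULPA.of]
    induction a using Unitization.ind with
    | inl_add_inr k l =>
      refine ⟨k • LPA.of K (.vertex c.source) + l * LPA.of K (.vertex c.source), ?_⟩
      rw [add_mul, Unitization.inl_mul_inr, Unitization.inr_add, Unitization.inr_mul]
  obtain ⟨F, hF⟩ := LPA.exists_unit b
  refine ⟨F, Subtype.ext ?_⟩
  change ((LPA.unit F : E.LPA K) : Unitization K (E.LPA K)) * a = a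
  rw [hb, ← Unitization.inr_mul, hF]

variable (K) in
/-- The left ideal `L v` as a unital module. -/
def projModule : E.UnitalModules K :=
  ⟨ModuleCat.of (E.ULPA K) (leftIdeal K c), isUnital_leftIdeal c⟩

variable (K) {c} in
/-- The morphism from `L v` to a unital module that is given by an element. -/
def evalHom (N : E.UnitalModules K) (n : N.obj) : projModule K c ⟶ N :=
  ObjectProperty.homMk (ModuleCat.ofHom
    ((LinearMap.toSpanSingleton (E.ULPA K) N.obj n).comp (leftIdeal K c).subtype))

theorem projModule_hom_ext {N : E.UnitalModules K} {f g : projModule K c ⟶ N}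
    (h : f.hom.hom (leftIdealGen K c) = g.hom.hom (leftIdealGen K c)) : f = g := by
  refine ObjectProperty.hom_ext _ (ModuleCat.hom_ext (LinearMap.ext fun a => ?_))
  have h1 := smul_leftIdealGen (K := K) (c := c) a
  have hf := f.hom.hom.map_smul (a : leftIdeal K c).1 (leftIdealGen K c)
  have hg := g.hom.hom.map_smul (a : leftIdeal K c).1 (leftIdealGen K c)
  rw [h, ← hg] at hf
  have h2 : ((a : leftIdeal K c).1 • leftIdealGen K c : leftIdeal K c) = a := h1
  erw [h2] at hf
  exact hf

theorem vert_smul_hom {N : E.UnitalModules K} (f : projModule K c ⟶ N) :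
    c.vert K • (f.hom.hom (leftIdealGen K c) : N.obj) = f.hom.hom (leftIdealGen K c) := by
  refine (f.hom.hom.map_smul (c.vert K) (leftIdealGen K c)).symm.trans ?_
  exact congrArg f.hom.hom (Subtype.ext (c.vert_mul_vert K))

/-- Together with `projModule_hom_ext` and `vert_smul_hom` this identifies `Hom(L v, N)` with `v N`.
-/
theorem evalHom_hom {N : E.UnitalModules K} (f : projModule K c ⟶ N) :
    evalHom K N (f.hom.hom (leftIdealGen K c)) = f :=
  projModule_hom_ext c (vert_smul_hom c f)

/-- The inclusion into all modules preserves epimorphisms, so `e` is surjective and the image of `v`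
has a preimage `n`. It need not satisfy `v n = n`, but the map given by `n` sends `v` to `v n`,
which has the right image. -/
instance : Projective (projModule K c) where
  factors {N M} f e _ := by
    have := (E.isUnital K).preservesEpimorphisms_ι_of_isNormalMonoCategory
    have he : Function.Surjective e.hom.hom :=
      (ModuleCat.epi_iff_surjective e.hom).mp (inferInstanceAs (Epi ((E.isUnital K).ι.map e)))
    obtain ⟨n, hn⟩ := he (f.hom.hom (leftIdealGen K c))
    refine ⟨evalHom K N n, projModule_hom_ext c ?_⟩
    refine Eq.trans ?_ (vert_smul_hom c f)
    rw [← hn]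
    exact e.hom.hom.map_smul (c.vert K) n

variable {p : K[X]} (hp : IsBasicIrreducible p)

/-- Right multiplication by `p(c)` on `L v`. -/
def mulPolyHom (p : K[X]) : projModule K c ⟶ projModule K c :=
  evalHom K (projModule K c) (⟨c.polyElt K p, mem_leftIdeal.mpr (c.polyElt_mul_vert K p)⟩ :
    leftIdeal K c)

/-- The map from `L v` to `V^p_{[c^∞]}` that is given by `c^∞`. -/
def toV : projModule K c ⟶ V c p hp := evalHom K (V c p hp) (TwistedSpace.single c hp c.basePath 1)

theorem mulPolyHom_comp_toV : mulPolyHom c p ≫ toV c hp = 0 := by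
  refine projModule_hom_ext c ?_
  change (c.vert K * c.polyElt K p) • TwistedSpace.single c hp c.basePath 1 = 0
  rw [Cycle.vert_mul_polyElt, polyElt_smul_base]

/-- The short exact sequence `0 → L v → L v → V^p_{[c^∞]} → 0`. -/
def resolution : ShortComplex (E.UnitalModules K) :=
  ShortComplex.mk (mulPolyHom c p) (toV c hp) (mulPolyHom_comp_toV c hp)

theorem resolution_shortExact : (resolution c hp).ShortExact := by
  -- Exactness is tested in the category of all modules, where it is a statement about elements.
  refine ShortExact.reflects_shortExact_of_faithful (E.isUnital K).ι ?_
  refine @ShortComplex.ShortExact.mk _ _ _ _ ?_ ?_ ?_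
  · rw [ShortComplex.moduleCat_exact_iff]
    intro a ha
    obtain ⟨b, hb⟩ := exists_mul_polyElt hp (mem_leftIdeal.mp (a : leftIdeal K c).2) ha
    -- Replacing `b` by `b v` gives an element of `L v` without changing the product with `p(c) = v
    -- p(c)`.
    refine ⟨(⟨b * c.vert K, mem_leftIdeal.mpr (by rw [mul_assoc, Cycle.vert_mul_vert])⟩ :
      leftIdeal K c), Subtype.ext ?_⟩
    refine Eq.trans ?_ hb.symm
    change b * c.vert K * c.polyElt K p = _
    rw [mul_assoc, Cycle.vert_mul_polyElt]
  · refine (ModuleCat.mono_iff_injective _).mpr ?_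
    refine (injective_iff_map_eq_zero _).mpr fun a ha => Subtype.ext ?_
    exact eq_zero_of_mul_polyElt hp.2 (mem_leftIdeal.mp (a : leftIdeal K c).2)
      (congrArg Subtype.val ha)
  · refine (ModuleCat.epi_iff_surjective _).mpr fun y => ?_
    obtain ⟨a, ha⟩ := exists_smul_base (hp := hp) y
    refine ⟨(⟨a * c.vert K, mem_leftIdeal.mpr (by rw [mul_assoc, Cycle.vert_mul_vert])⟩ :
      leftIdeal K c), ?_⟩
    refine Eq.trans ?_ ha
    change (a * c.vert K) • TwistedSpace.single c hp c.basePath 1 = _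
    rw [mul_smul, vert_smul_base]

end Resolution

/-! ### The connecting homomorphism of a short exact sequence with projective middle term -/

section Connecting

variable {C : Type*} [Category* C] [Abelian C] [HasExt.{w} C] (K : Type*) [CommRing K] [Linear K C]
  {S : ShortComplex C} (hS : S.ShortExact) (N : C)

/-- The connecting homomorphism `Hom(X₁, N) → Ext¹(X₃, N)` of a short exact sequence. -/
def connecting : (S.X₁ ⟶ N) →ₗ[K] Abelian.Ext S.X₃ N 1 :=
  (Abelian.Ext.precompOfLinear hS.extClass K N (add_zero 1)).comp
    (Abelian.Ext.linearEquiv₀ (R := K)).symm.toLinearMap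

theorem connecting_apply (f : S.X₁ ⟶ N) :
    connecting K hS N f = hS.extClass.comp (Abelian.Ext.mk₀ f) (add_zero 1) := rfl

/-- In the long exact sequence `Ext¹(X₂, N)` vanishes. With the kernel found in
`connecting_eq_zero_iff`, this makes `Ext¹(X₃, N)` the cokernel of precomposition with `S.f`. -/
theorem connecting_surjective [Projective S.X₂] : Function.Surjective (connecting K hS N) := by
  intro x
  obtain ⟨y, hy⟩ := Abelian.Ext.contravariant_sequence_exact₃ hS N x
    (Abelian.Ext.eq_zero_of_projective _) (add_zero 1)
  obtain ⟨f, rfl⟩ := Abelian.Ext.addEquiv₀.symm.surjective y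
  exact ⟨f, hy⟩

theorem connecting_eq_zero_iff {N : C} (f : S.X₁ ⟶ N) :
    connecting K hS N f = 0 ↔ ∃ g, S.f ≫ g = f := by
  constructor
  · intro h
    obtain ⟨y, hy⟩ := Abelian.Ext.contravariant_sequence_exact₁ hS N
      (Abelian.Ext.mk₀ f) (add_zero 1) h
    obtain ⟨g, rfl⟩ := Abelian.Ext.addEquiv₀.symm.surjective y
    refine ⟨g, Abelian.Ext.addEquiv₀.symm.injective ?_⟩
    change Abelian.Ext.mk₀ (S.f ≫ g) = Abelian.Ext.mk₀ f
    rw [← Abelian.Ext.mk₀_comp_mk₀]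
    exact hy
  · rintro ⟨g, rfl⟩
    rw [connecting_apply, ← Abelian.Ext.mk₀_comp_mk₀]
    exact hS.extClass_comp_assoc _

end Connecting

/-! ### The computation of `Ext¹` -/

section Ext

variable {E : DirectedGraph.{u}} {K : Type v} [Field K] (c e : E.Cycle) {p q : K[X]}
  (hp : IsBasicIrreducible p) (hq : IsBasicIrreducible q)

variable {D : Type*} [AddCommGroup D] [Module K D]

/-- `Ext¹` of `V^p_{[c^∞]}` and `V^q_{[e^∞]}` is the cokernel of `p(c)` on `v V^q_{[e^∞]}`,
where `v` is the source of `c`. -/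
theorem nonempty_ext_equiv (T : D →ₗ[K] D) (ψ : D →ₗ[K] TwistedSpace e q hq)
    (hinj : Function.Injective ψ) (hψ : ∀ d, c.vert K • ψ d = ψ d)
    (hsurj : ∀ n, c.vert K • n = n → ∃ d, ψ d = n) (hT : ∀ d, ψ (T d) = c.elt K • ψ d) :
    Nonempty ((D ⧸ LinearMap.range (aeval T p)) ≃ₗ[K]
      Abelian.Ext (V c p hp) (V e q hq) 1) := by
  -- The space `D` is a model of `v N`, with `T` in the role of `c`; `ev` turns it into a model of
  -- `Hom(L v, N)`.
  let ev : D →ₗ[K] (projModule K c ⟶ V e q hq) :=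
    { toFun d := evalHom K (V e q hq) (ψ d)
      map_add' x y := by
        refine projModule_hom_ext c ?_
        change c.vert K • ψ (x + y) = c.vert K • ψ x + c.vert K • ψ y
        rw [map_add, smul_add]
      map_smul' k x := by
        refine projModule_hom_ext c ?_
        change c.vert K • ψ (k • x) = algebraMap K (E.ULPA K) k • c.vert K • ψ x
        rw [algebraMap_smul, hψ, hψ, map_smul] }
  have haeval : ∀ (f : K[X]) d, ψ (aeval T f d) = aeval (c.elt K) f • ψ d := by
    intro f
    induction f using Polynomial.induction_on with
    | C a =>
      intro d
      rw [aeval_C, aeval_C, Module.algebraMap_end_apply, map_smul, algebraMap_smul]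
    | add f g hf hg =>
      intro d
      rw [map_add, map_add, LinearMap.add_apply, map_add, hf, hg, add_smul]
    | monomial n a ih =>
      intro d
      have h : (C a * X ^ (n + 1) : K[X]) = X * (C a * X ^ n) := by ring
      rw [h, map_mul (aeval T) X, map_mul (aeval _) X, aeval_X, aeval_X, Module.End.mul_apply, hT,
        ih, mul_smul]
  have hev : ∀ f, ∃ d, ev d = f := by
    intro f
    obtain ⟨d, hd⟩ := hsurj (f.hom.hom (leftIdealGen K c)) (vert_smul_hom c f)
    refine ⟨d, ?_⟩
    change evalHom K (V e q hq) (ψ d) = f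
    rw [hd]
    exact evalHom_hom c f
  -- Precomposition with the first map of the resolution corresponds to `p(T)` on `D`.
  have hcomp : ∀ d, mulPolyHom c p ≫ ev d = ev (aeval T p d) := by
    intro d
    refine projModule_hom_ext c ?_
    change (c.vert K * c.polyElt K p) • ψ d = c.vert K • ψ (aeval T p d)
    rw [Cycle.vert_mul_polyElt, hψ, haeval, Cycle.polyElt, mul_smul, hψ]
  have hevinj : ∀ d d', ev d = ev d' → d = d' := by
    intro d d' h
    have h1 : c.vert K • ψ d = c.vert K • ψ d' :=
      congrArg (fun f : projModule K c ⟶ V e q hq => f.hom.hom (leftIdealGen K c)) h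
    rw [hψ, hψ] at h1
    exact hinj h1
  let G : D →ₗ[K] Abelian.Ext (V c p hp) (V e q hq) 1 :=
    (connecting K (resolution_shortExact c hp) (V e q hq)).comp ev
  have : Projective (resolution c hp).X₂ := inferInstanceAs (Projective (projModule K c))
  have hG : Function.Surjective G :=
    (connecting_surjective K (resolution_shortExact c hp) (V e q hq)).comp hev
  have hker : LinearMap.range (aeval T p) = LinearMap.ker G := by
    ext d
    refine Iff.trans ?_ (connecting_eq_zero_iff K (resolution_shortExact c hp) (ev d)).symm
    constructor
    · rintro ⟨d', rfl⟩
      exact ⟨ev d', hcomp d'⟩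
    · rintro ⟨g, hg⟩
      obtain ⟨d', rfl⟩ := hev g
      exact ⟨d', hevinj _ _ ((hcomp d').symm.trans hg)⟩
  exact ⟨(Submodule.quotEquivOfEq _ _ hker).trans (G.quotKerEquivOfSurjective hG)⟩

end Ext

end DirectedGraph

namespace DirectedGraph

/-! ### Exclusive cycles -/

namespace Cycle

variable {E : DirectedGraph.{u}} {c e : E.Cycle}

/-- The cycle given by a closed path without repeated sources. -/
def ofFun (g : ℕ → E.Edge) (n : ℕ) (hchain : ∀ i < n, E.r (g i) = E.s (g (i + 1)))
    (hclosed : E.r (g n) = E.s (g 0)) (hinj : ∀ a b, a < b → b ≤ n → E.s (g a) ≠ E.s (g b)) :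
    E.Cycle where
  edges := (List.range (n + 1)).map g
  ne_nil := by simp
  isChain := by
    refine List.isChain_iff_getElem.mpr fun i hi => ?_
    simp only [List.length_map, List.length_range] at hi
    simpa using hchain i (by omega)
  closed := by
    rw [List.getLast_eq_getElem, List.head_eq_getElem]
    simpa using hclosed
  nodup := by
    rw [List.map_map]
    refine List.Nodup.map_on ?_ List.nodup_range
    intro a ha b hb hab
    rw [List.mem_range] at ha hb
    rcases lt_trichotomy a b with h | h | h
    · exact absurd hab (hinj a b h (by omega))
    · exact h
    · exact absurd hab.symm (hinj b a h (by omega))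

/-- An edge that lies on a closed path is the first edge of a cycle. -/
theorem exists_first_eq (g : ℕ → E.Edge) (n : ℕ) (hchain : ∀ i < n, E.r (g i) = E.s (g (i + 1)))
    (hclosed : E.r (g n) = E.s (g 0)) : ∃ d : E.Cycle, d.first = g 0 := by
  induction n using Nat.strong_induction_on generalizing g with
  | _ n ih =>
    by_cases hinj : ∀ a b, a < b → b ≤ n → E.s (g a) ≠ E.s (g b)
    · refine ⟨ofFun g n hchain hclosed hinj, ?_⟩
      rw [first, List.head_eq_getElem]
      simp [ofFun]
    · push Not at hinj
      obtain ⟨a, b, hab, hbn, hs⟩ := hinj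
      -- If the repeated source is the starting point, the path is stopped at its first return there
      -- given by `b`; otherwise the closed piece from `a` to `b - 1` is cut out. Both keep the edge
      -- `g 0` and shorten the path.
      rcases Nat.eq_zero_or_pos a with rfl | ha
      · refine ih (b - 1) (by omega) g (fun i hi => hchain i (by omega)) ?_
        rw [hchain (b - 1) (by omega), Nat.sub_add_cancel (by omega), hs]
      · have := ih (n - (b - a)) (by omega) (fun i => if i < a then g i else g (i + (b - a))) ?_ ?_
        · simpa [ha] using this
        · intro i hi
          by_cases h1 : i + 1 < a
          · simpa [h1, show i < a by omega] using hchain i (by omega)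
          · by_cases h2 : i < a
            · have h3 : i + 1 = a := by omega
              simp only [h2, h1, if_true, if_false]
              rw [hchain i (by omega), h3, hs]
              congr 2
              omega
            · simp only [h2, h1, if_false]
              rw [hchain (i + (b - a)) (by omega)]
              congr 2
              omega
        · simp only [ha, if_true, show ¬ n - (b - a) < a by omega, if_false]
          rw [show n - (b - a) + (b - a) = n by omega, hclosed]

/-- An edge that lies on a cycle and starts on an exclusive cycle belongs to the latter. -/
theorem IsExclusive.eq_of_s_eq (hc : c.IsExclusive) {d : E.Cycle} {f : E.Edge} (hf : f ∈ c.edges)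
    (h : E.s f = E.s d.first) : d.first = f := by
  have hd : d.first ∈ d.edges := List.head_mem _
  by_cases hr : c.IsRotation d
  · exact c.eq_of_s_eq (hr.perm.mem_iff.mpr hd) hf h.symm
  · exact absurd h (hc d hr f hf _ hd)

/-- The only infinite path that is tail equivalent to `c^∞` and starts at the source of `c` is
`c^∞` itself, for an exclusive cycle `c`. -/
theorem IsExclusive.eq_infty (hc : c.IsExclusive) {x : E.InfPath} (hx : x.TailEquiv c.infty)
    (hs : x.source = c.source) : x = c.infty := by
  obtain ⟨m, hm⟩ := c.exists_shift_eq hx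
  -- If `x` is at a vertex of `c`, it later returns to that vertex, since it ends in `c^∞`. So its
  -- next edge lies on a cycle through this vertex, and exclusivity forces it to be the edge of `c`.
  have key : ∀ i, E.s (x.edge i) = E.s (c.infty.edge i) → x.edge i = c.infty.edge i := by
    intro i hi
    have hle : i + 1 ≤ (i + 1) * c.edges.length := Nat.le_mul_of_pos_right _ c.length_pos
    -- The `i + 1` extra rounds guarantee that this position comes strictly after `i`.
    have hback : x.edge (m + ((i + 1) * c.edges.length + i)) = c.infty.edge i := by
      rw [← infty_edge_mul_add c (i + 1) i, ← hm]
      rfl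
    obtain ⟨d, hd⟩ := exists_first_eq (fun k => x.edge (i + k))
      (m + ((i + 1) * c.edges.length + i) - 1 - i) (fun k _ => x.chain (i + k)) (by
        rw [x.chain, add_zero, hi, ← hback]
        congr 2
        omega)
    rw [add_zero] at hd
    rw [← hd]
    exact hc.eq_of_s_eq (c.infty_edge_mem i) (by rw [hd, hi])
  have hsrc : ∀ i, E.s (x.edge i) = E.s (c.infty.edge i) := by
    intro i
    induction i with
    | zero => exact hs.trans c.source_infty.symm
    | succ i ih => rw [← x.chain, key i ih, c.infty.chain]
  exact InfPath.ext (funext fun i => key i (hsrc i))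

theorem IsRotation.tailEquiv (h : c.IsRotation e) : c.infty.TailEquiv e.infty := by
  obtain ⟨n, hn⟩ := h
  refine ⟨n, 0, fun k => ?_⟩
  have hlen : e.edges.length = c.edges.length := by rw [← hn, List.length_rotate]
  simp only [infty_edge, zero_add, ← hn, List.getElem_rotate, List.length_rotate, Nat.mod_add_mod,
    add_comm n k]

/-! ### Paths that start with powers of a cycle -/

variable (c) in
/-- The infinite path `cⁿ x`. -/
def prepend (n : ℕ) (x : E.InfPath) (h : x.source = c.source) : E.InfPath where
  edge i := if i < n * c.edges.length then c.infty.edge i else x.edge (i - n * c.edges.length)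
  chain i := by
    by_cases h1 : i + 1 < n * c.edges.length
    · simp only [h1, show i < n * c.edges.length by omega, if_true, c.infty.chain]
    · by_cases h2 : i < n * c.edges.length
      · simp only [h2, h1, if_true, if_false]
        rw [c.infty.chain, show i + 1 = n * c.edges.length + 0 by omega, infty_edge_mul_add,
          Nat.add_sub_cancel_left]
        exact c.source_infty.trans h.symm
      · simp only [h2, h1, if_false]
        rw [x.chain]
        congr 2
        omega

theorem prepend_edge_of_lt {n : ℕ} {x : E.InfPath} (h : x.source = c.source) {i : ℕ}
    (hi : i < n * c.edges.length) : (c.prepend n x h).edge i = c.infty.edge i := if_pos hi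

theorem prepend_edge_add (n : ℕ) {x : E.InfPath} (h : x.source = c.source) (i : ℕ) :
    (c.prepend n x h).edge (n * c.edges.length + i) = x.edge i := by
  simp [prepend]

theorem shift_prepend (n : ℕ) {x : E.InfPath} (h : x.source = c.source) :
    InfPath.shift (n * c.edges.length) (c.prepend n x h) = x := by
  ext i
  exact prepend_edge_add n h i

theorem source_prepend (n : ℕ) {x : E.InfPath} (h : x.source = c.source) :
    (c.prepend n x h).source = c.source := by
  have hpos := c.length_pos
  cases n with
  | zero => simpa [InfPath.source, prepend] using h
  | succ n =>
    rw [InfPath.source, prepend_edge_of_lt h (Nat.mul_pos (by omega) hpos)]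
    exact c.source_infty

theorem divides_prepend_succ (n : ℕ) {x : E.InfPath} (h : x.source = c.source) :
    c.Divides (c.prepend (n + 1) x h) := fun i hi => by
  rw [prepend_edge_of_lt h (by rw [add_mul]; omega), infty_edge_of_lt c hi]

theorem shift_prepend_succ (n : ℕ) {x : E.InfPath} (h : x.source = c.source) :
    InfPath.shift c.edges.length (c.prepend (n + 1) x h) = c.prepend n x h := by
  ext i
  by_cases hi : i < n * c.edges.length
  · rw [prepend_edge_of_lt h hi]
    refine (prepend_edge_of_lt h (by rw [add_mul]; omega)).trans ?_
    simpa using infty_edge_mul_add c 1 i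
  · obtain ⟨k, rfl⟩ := Nat.exists_eq_add_of_le (not_lt.mp hi)
    rw [prepend_edge_add]
    have := prepend_edge_add (c := c) (n + 1) h k
    rw [← this]
    simp only [InfPath.shift]
    congr 1
    ring

theorem tailEquiv_prepend (n : ℕ) {x y : E.InfPath} (h : x.source = c.source)
    (hx : x.TailEquiv y) : (c.prepend n x h).TailEquiv y :=
  (InfPath.tailEquiv_of_shift_eq (n := 0)
    ((shift_prepend n h).trans (InfPath.shift_zero x).symm)).trans hx

/-- The powers of `c` before a path that does not start with `c` are determined by the result. -/
theorem prepend_injective {n n' : ℕ} {x x' : E.InfPath} {h : x.source = c.source}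
    {h' : x'.source = c.source} (hx : ¬ c.Divides x) (hx' : ¬ c.Divides x')
    (heq : c.prepend n x h = c.prepend n' x' h') : n = n' ∧ x = x' := by
  -- If `n < n'`, deleting `n` rounds from the common path leaves `x` on one side and a path that
  -- still starts with `c` on the other.
  have step : ∀ {n n' : ℕ} {x x' : E.InfPath} {h : x.source = c.source} {h' : x'.source = c.source},
      ¬ c.Divides x → c.prepend n x h = c.prepend n' x' h' → n' ≤ n := by
    intro n n' x x' h h' hx heq
    by_contra! hlt
    refine hx fun i hi => ?_
    have hle : (n + 1) * c.edges.length ≤ n' * c.edges.length := Nat.mul_le_mul_right _ hlt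
    rw [add_mul, one_mul] at hle
    rw [← prepend_edge_add (c := c) n h i, heq, prepend_edge_of_lt h' (by omega),
      infty_edge_mul_add, infty_edge_of_lt c hi]
  obtain rfl : n = n' := le_antisymm (step hx' heq.symm) (step hx heq)
  exact ⟨rfl, by rw [← shift_prepend n h, heq, shift_prepend]⟩

/-- A path from the source of `c` other than `c^∞` is of the form `cⁿ x`, where `x` does not start
with `c`. -/
theorem exists_prepend_eq {y : E.InfPath} (hy : y.source = c.source) (hne : y ≠ c.infty) :
    ∃ (n : ℕ) (x : E.InfPath) (h : x.source = c.source), ¬ c.Divides x ∧ c.prepend n x h = y := by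
  classical
  have hpos := c.length_pos
  have hblock : ∀ n, c.Divides (InfPath.shift (n * c.edges.length) y) → ∀ i < c.edges.length,
      y.edge (n * c.edges.length + i) = c.infty.edge (n * c.edges.length + i) := by
    intro n hn i hi
    rw [infty_edge_mul_add, infty_edge_of_lt c hi, ← hn i hi]
    rfl
  -- The least such `n` is the number of rounds to split off; if there were none, `y` would consist
  -- of rounds through `c` only.
  have hex : ∃ n, ¬ c.Divides (InfPath.shift (n * c.edges.length) y) := by
    by_contra! hall
    refine hne (InfPath.ext (funext fun i => ?_))
    have := hblock (i / c.edges.length) (hall _) (i % c.edges.length) (Nat.mod_lt _ hpos)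
    rwa [mul_comm, Nat.div_add_mod] at this
  have hmin : ∀ i < Nat.find hex * c.edges.length, y.edge i = c.infty.edge i := by
    intro i hi
    have hlt : i / c.edges.length < Nat.find hex := (Nat.div_lt_iff_lt_mul hpos).mpr hi
    have := hblock (i / c.edges.length) (not_not.mp (Nat.find_min hex hlt)) (i % c.edges.length)
      (Nat.mod_lt _ hpos)
    rwa [mul_comm, Nat.div_add_mod] at this
  have hsrc : (InfPath.shift (Nat.find hex * c.edges.length) y).source = c.source := by
    rcases Nat.eq_zero_or_pos (Nat.find hex) with h0 | h0
    · rw [h0, zero_mul, InfPath.shift_zero, hy]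
    · have h1 : 0 < Nat.find hex * c.edges.length := Nat.mul_pos h0 hpos
      have h2 := y.chain (Nat.find hex * c.edges.length - 1)
      rw [hmin _ (by omega), c.infty.chain, Nat.sub_add_cancel h1] at h2
      refine h2.symm.trans ?_
      rw [← add_zero (Nat.find hex * c.edges.length), infty_edge_mul_add]
      exact c.source_infty
  refine ⟨Nat.find hex, _, hsrc, Nat.find_spec hex, InfPath.ext (funext fun i => ?_)⟩
  by_cases hi : i < Nat.find hex * c.edges.length
  · rw [prepend_edge_of_lt hsrc hi, hmin i hi]
  · obtain ⟨k, hk⟩ := Nat.exists_eq_add_of_le (not_lt.mp hi)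
    rw [hk, prepend_edge_add]
    rfl

end Cycle

end DirectedGraph

namespace DirectedGraph

/-! ### Evaluation of the cokernel in the two cases -/

section Cases

variable {E : DirectedGraph.{u}} {K : Type v} [Field K] {c e : E.Cycle} {p q : K[X]}

/-- The cofactor is a non-zero constant, and equality of the constant terms `-1` forces it to be
`1`. -/
theorem IsBasicIrreducible.eq_of_dvd (hp : IsBasicIrreducible p) (hq : IsBasicIrreducible q)
    (h : q ∣ p) : p = q := by
  obtain ⟨r, rfl⟩ := h
  obtain ⟨a, -, rfl⟩ := Polynomial.isUnit_iff.mp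
    ((hp.1.isUnit_or_isUnit rfl).resolve_left hq.1.not_isUnit)
  have h1 := hp.2
  rw [coeff_mul_C, hq.2, neg_one_mul, neg_inj] at h1
  rw [h1, C_1, mul_one]

theorem rank_adjoinRoot {F : Type v} [Field F] {f : F[X]} (hf : f ≠ 0) :
    Module.rank F (AdjoinRoot f) = f.natDegree := by
  have := (AdjoinRoot.powerBasis hf).finite
  rw [← Module.finrank_eq_rank, (AdjoinRoot.powerBasis hf).finrank, AdjoinRoot.powerBasis_dim]

/-! ### Cycles that are cyclic permutations of each other -/

/-- `Ext¹` for cyclic permutations of one exclusive cycle. -/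
theorem nonempty_ext_equiv_of_isRotation (hc : c.IsExclusive) (hp : IsBasicIrreducible p)
    (hq : IsBasicIrreducible q) (h : c.IsRotation e) :
    Nonempty ((AdjoinRoot q ⧸ LinearMap.range (LinearMap.mulLeft K (AdjoinRoot.mk q p))) ≃ₗ[K]
      Abelian.Ext (V c p hp) (V e q hq) 1) := by
  classical
  -- By exclusivity `z` is the only path of `[e^∞]` that starts at `v`, so `v N` is the line over
  -- `K[x]/(q)` spanned by it.
  let z : e.TailClass := ⟨c.infty, h.tailEquiv⟩
  let ψ : AdjoinRoot q →ₗ[K] TwistedSpace e q hq :=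
    { toFun t := TwistedSpace.single e hq z t
      map_add' := TwistedSpace.single_add z
      map_smul' k t := (TwistedSpace.smul_single k z t).symm }
  have hv : ∀ (x : e.TailClass) (t : AdjoinRoot q), c.vert K • TwistedSpace.single e hq x t =
      if c.source = x.1.source then TwistedSpace.single e hq x t else 0 := fun x t =>
    TwistedSpace.vertex_smul_single _ _ _
  have h1 := nonempty_ext_equiv c e hp hq (LinearMap.mulLeft K (AdjoinRoot.root q)) ψ
    (Finsupp.single_injective z) (fun d => (hv z d).trans (if_pos c.source_infty.symm)) (by
      have hall : ∀ n : TwistedSpace e q hq, ∃ d, ψ d = c.vert K • n := by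
        intro n
        induction n using TwistedSpace.induction with
        | zero => exact ⟨0, by rw [map_zero, smul_zero]⟩
        | add x y hx hy =>
          obtain ⟨d, hd⟩ := hx
          obtain ⟨d', hd'⟩ := hy
          exact ⟨d + d', by rw [map_add, hd, hd', smul_add]⟩
        | single x t =>
          rw [hv]
          split_ifs with hx
          · obtain rfl : x = z :=
              Subtype.ext (hc.eq_infty (x.2.trans h.tailEquiv.symm) hx.symm)
            exact ⟨t, rfl⟩
          · exact ⟨0, map_zero _⟩
      intro n hn
      obtain ⟨d, hd⟩ := hall n
      exact ⟨d, hd.trans hn⟩) (fun t => by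
      refine Eq.trans ?_ (TwistedSpace.elt_smul_single (c := e) c (x := z) (y := z) c.divides_infty
        (by simpa using c.shift_infty 1) t).symm
      rw [pathWeight_eq_root h]
      rfl)
  have h2 : aeval (LinearMap.mulLeft K (AdjoinRoot.root q)) p =
      LinearMap.mulLeft K (AdjoinRoot.mk q p) := by
    rw [← AdjoinRoot.aeval_eq]
    exact Polynomial.aeval_algHom_apply (Algebra.lmul K (AdjoinRoot q)) _ p
  rwa [h2] at h1

/-- The class of `p` is non-zero in the field `K[x]/(q)`, so multiplication by it is onto and the
cokernel vanishes. -/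
theorem rank_ext_of_isRotation_of_ne (hc : c.IsExclusive) (hp : IsBasicIrreducible p)
    (hq : IsBasicIrreducible q) (h : c.IsRotation e) (hne : p ≠ q) :
    Module.rank K (Abelian.Ext (V c p hp) (V e q hq) 1) = 0 := by
  have := Fact.mk hq.1
  obtain ⟨f⟩ := nonempty_ext_equiv_of_isRotation hc hp hq h
  have hne' : AdjoinRoot.mk q p ≠ 0 := fun h0 =>
    hne (hp.eq_of_dvd hq (AdjoinRoot.mk_eq_zero.mp h0))
  have htop : LinearMap.range (LinearMap.mulLeft K (AdjoinRoot.mk q p)) = ⊤ := by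
    refine LinearMap.range_eq_top.mpr fun t => ⟨(AdjoinRoot.mk q p)⁻¹ * t, ?_⟩
    exact mul_inv_cancel_left₀ hne' t
  have : Subsingleton (AdjoinRoot q ⧸ LinearMap.range (LinearMap.mulLeft K (AdjoinRoot.mk q p))) :=
    Submodule.Quotient.subsingleton_iff.mpr htop
  have := f.symm.toEquiv.subsingleton
  exact rank_subsingleton' K _

/-- The class of `p` modulo `p` is zero, so the cokernel is all of `K[x]/(p)`. -/
theorem rank_ext_of_isRotation_of_eq (hc : c.IsExclusive) (hp : IsBasicIrreducible p)
    (hq : IsBasicIrreducible q) (h : c.IsRotation e) (heq : p = q) :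
    Module.rank K (Abelian.Ext (V c p hp) (V e q hq) 1) = p.natDegree := by
  subst heq
  obtain ⟨f⟩ := nonempty_ext_equiv_of_isRotation hc hp hq h
  have hbot : LinearMap.range (LinearMap.mulLeft K (AdjoinRoot.mk p p)) = ⊥ := by
    rw [AdjoinRoot.mk_self, LinearMap.mulLeft_zero_eq_zero, LinearMap.range_zero]
  have h1 := ((Submodule.quotEquivOfEqBot _ hbot).symm.trans f).lift_rank_eq
  rw [rank_adjoinRoot hp.1.ne_zero, Cardinal.lift_natCast] at h1
  exact Cardinal.lift_injective (h1.symm.trans (Cardinal.lift_natCast _).symm)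

/-! ### Cycles that are not cyclic permutations of each other -/

variable (hq : IsBasicIrreducible q)

/-- The path `cⁿ μ` for `μ` in `L_{c,e}`, as an element of `[e^∞]`. -/
def prependClass (x : pathsBetween c e × ℕ) : e.TailClass :=
  ⟨c.prepend x.2 x.1.1 x.1.2.2.2, Cycle.tailEquiv_prepend _ _ x.1.2.1⟩

theorem prependClass_injective :
    Function.Injective (prependClass : pathsBetween c e × ℕ → e.TailClass) := by
  rintro ⟨⟨x, hx⟩, n⟩ ⟨⟨x', hx'⟩, n'⟩ h
  obtain ⟨rfl, rfl⟩ := Cycle.prepend_injective (h := hx.2.2) (h' := hx'.2.2) hx.2.1 hx'.2.1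
    (congrArg Subtype.val h)
  rfl

theorem exists_prependClass_eq (hr : ¬ c.IsRotation e) (hc : c.IsExclusive) {y : e.TailClass}
    (hy : c.source = y.1.source) : ∃ x : pathsBetween c e × ℕ, prependClass x = y := by
  -- If `c^∞` were tail equivalent to `e^∞`, the two cycles would share an edge, against
  -- exclusivity.
  have hne : y.1 ≠ c.infty := by
    intro h
    obtain ⟨m, n, hmn⟩ := y.2
    have h0 := hmn 0
    rw [h] at h0
    exact hc e hr _ (c.infty_edge_mem _) _ (e.infty_edge_mem _) (congrArg E.s h0)
  obtain ⟨n, x, hx, hd, hxy⟩ := Cycle.exists_prepend_eq hy.symm hne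
  refine ⟨⟨⟨x, ?_, hd, hx⟩, n⟩, Subtype.ext hxy⟩
  rw [← Cycle.shift_prepend n hx, hxy]
  exact InfPath.tailEquiv_shift y.2 _

/-- The polynomials in `c` with coefficients in `K' = K[x]/(q)`, applied to the elements of
`L_{c,e}`. -/
def polyToTwisted (c : E.Cycle) :
    (pathsBetween c e →₀ (AdjoinRoot q)[X]) →ₗ[K] TwistedSpace e q hq :=
  ((Finsupp.lmapDomain (AdjoinRoot q) (AdjoinRoot q) prependClass ∘ₗ
    (Finsupp.curryLinearEquiv (AdjoinRoot q)).symm.toLinearMap ∘ₗ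
    (Finsupp.mapRange.linearEquiv ((Polynomial.toFinsuppIsoLinear (AdjoinRoot q)).trans
      (AddMonoidAlgebra.coeffLinearEquiv (AdjoinRoot q)))).toLinearMap).restrictScalars K :
    (pathsBetween c e →₀ (AdjoinRoot q)[X]) →ₗ[K] (e.TailClass →₀ AdjoinRoot q))

theorem polyToTwisted_injective : Function.Injective (polyToTwisted (e := e) hq c) :=
  (Finsupp.mapDomain_injective prependClass_injective).comp
    ((Finsupp.curryLinearEquiv (AdjoinRoot q)).symm.injective.comp (LinearEquiv.injective
      (Finsupp.mapRange.linearEquiv ((Polynomial.toFinsuppIsoLinear (AdjoinRoot q)).trans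
        (AddMonoidAlgebra.coeffLinearEquiv (AdjoinRoot q))))))

/-- The monomial `xⁿ` stands for `n` rounds through `c`, so multiplication by the variable becomes
the action of `c`. -/
theorem polyToTwisted_monomial (x : pathsBetween c e) (n : ℕ) (t : AdjoinRoot q) :
    polyToTwisted hq c (Finsupp.single x (monomial n t)) =
      TwistedSpace.single e hq (prependClass (x, n)) t := by
  refine (congrArg (Finsupp.mapDomain prependClass) ?_ :
    _ = Finsupp.mapDomain prependClass (Finsupp.single (x, n) t)).trans Finsupp.mapDomain_single
  rw [LinearMap.comp_apply, LinearEquiv.coe_coe, LinearEquiv.coe_coe, LinearEquiv.symm_apply_eq]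
  ext y m
  simp [Finsupp.mapRange_single]

/-- Multiplication by a polynomial on the finitely supported families of polynomials. -/
def mulFamily (ι : Type*) {R : Type*} [CommRing R] [Algebra K R] (f : R[X]) :
    (ι →₀ R[X]) →ₗ[K] (ι →₀ R[X]) :=
  Finsupp.mapRange.linearMap (LinearMap.mulLeft K f)

theorem mulFamily_apply {ι : Type*} {R : Type*} [CommRing R] [Algebra K R] (f : R[X])
    (d : ι →₀ R[X]) (i : ι) : mulFamily (K := K) ι f d i = f * d i := rfl

theorem mulFamily_single {ι : Type*} {R : Type*} [CommRing R] [Algebra K R] (f r : R[X])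
    (i : ι) : mulFamily (K := K) ι f (Finsupp.single i r) = Finsupp.single i (f * r) := by
  simp [mulFamily]

theorem aeval_mulFamily {ι : Type*} {R : Type*} [CommRing R] [Algebra K R] (p : K[X]) :
    aeval (mulFamily (K := K) ι (X : R[X])) p = mulFamily ι (p.map (algebraMap K R)) := by
  induction p using Polynomial.induction_on with
  | C a =>
    refine LinearMap.ext fun d => Finsupp.ext fun i => ?_
    rw [aeval_C, Module.algebraMap_end_apply, mulFamily_apply, map_C, Finsupp.smul_apply,
      ← algebraMap_smul R a (d i), smul_eq_C_mul]
  | add f g hf hg =>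
    rw [map_add, hf, hg]
    refine LinearMap.ext fun d => Finsupp.ext fun i => ?_
    simp only [LinearMap.add_apply, Finsupp.add_apply, mulFamily_apply, Polynomial.map_add, add_mul]
  | monomial n a ih =>
    have h : (C a * X ^ (n + 1) : K[X]) = X * (C a * X ^ n) := by ring
    rw [h, map_mul (aeval _) X, ih, aeval_X, Polynomial.map_mul _ (p := X), map_X]
    refine LinearMap.ext fun d => Finsupp.ext fun i => ?_
    simp only [Module.End.mul_apply, mulFamily_apply, mul_assoc]

/-- The cokernel of the multiplication by a polynomial on families of polynomials. -/
def mulFamilyQuotEquiv (ι : Type*) {F : Type*} [Field F] [Algebra K F] {f : F[X]} (hf : f ≠ 0) :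
    ((ι →₀ F[X]) ⧸ LinearMap.range (mulFamily (K := K) ι f)) ≃ₗ[K] (ι →₀ AdjoinRoot f) :=
  let G : (ι →₀ F[X]) →ₗ[K] (ι →₀ AdjoinRoot f) :=
    Finsupp.mapRange.linearMap ((AdjoinRoot.mkₐ f).toLinearMap.restrictScalars K)
  have hG : Function.Surjective G := fun y => by
    obtain ⟨x, hx⟩ := Finsupp.mapRange_surjective (AdjoinRoot.mk f) (map_zero _)
      AdjoinRoot.mk_surjective y
    exact ⟨x, hx⟩
  have hker : LinearMap.range (mulFamily (K := K) ι f) = LinearMap.ker G := by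
    ext d
    rw [LinearMap.mem_range, LinearMap.mem_ker]
    constructor
    · rintro ⟨d, rfl⟩
      refine Finsupp.ext fun i => ?_
      exact AdjoinRoot.mk_eq_zero.mpr (dvd_mul_right f (d i))
    · intro h
      -- The preimage is the coordinatewise quotient; `0 / f = 0` keeps its support finite.
      refine ⟨d.mapRange (· / f) (EuclideanDomain.zero_div), Finsupp.ext fun i => ?_⟩
      have hi : AdjoinRoot.mk f (d i) = 0 := congrArg (fun y : ι →₀ AdjoinRoot f => y i) h
      exact EuclideanDomain.mul_div_cancel' hf (AdjoinRoot.mk_eq_zero.mp hi)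
  (Submodule.quotEquivOfEq _ _ hker).trans (G.quotKerEquivOfSurjective hG)

/-- The paths `cⁿ λ` with `λ` in `L_{c,e}` form a basis of `v N` over `K[x]/(q)`, and `c` raises `n`
by one without a scalar. So `c` acts as the variable on families of polynomials, and `p(c)` as
multiplication by `p`. -/
theorem nonempty_ext_equiv_of_not_isRotation (hc : c.IsExclusive) (hp : IsBasicIrreducible p)
    (h : ¬ c.IsRotation e) :
    Nonempty (((pathsBetween c e →₀ (AdjoinRoot q)[X]) ⧸
      LinearMap.range (mulFamily (K := K) (pathsBetween c e)
        (p.map (algebraMap K (AdjoinRoot q))))) ≃ₗ[K] Abelian.Ext (V c p hp) (V e q hq) 1) := by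
  classical
  have hv : ∀ (x : e.TailClass) (t : AdjoinRoot q), c.vert K • TwistedSpace.single e hq x t =
      if c.source = x.1.source then TwistedSpace.single e hq x t else 0 := fun x t =>
    TwistedSpace.vertex_smul_single _ _ _
  have hind : ∀ P : (pathsBetween c e →₀ (AdjoinRoot q)[X]) → Prop, P 0 →
      (∀ x y, P x → P y → P (x + y)) → (∀ x n t, P (Finsupp.single x (monomial n t))) →
      ∀ d, P d := by
    intro P h0 hadd hmon d
    induction d using Finsupp.induction_linear with
    | zero => exact h0
    | add x y hx hy => exact hadd x y hx hy
    | single x r =>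
      induction r using Polynomial.induction_on' with
      | add r s hr hs => rw [Finsupp.single_add]; exact hadd _ _ hr hs
      | monomial n t => exact hmon x n t
  have h1 := nonempty_ext_equiv c e hp hq (mulFamily (K := K) (pathsBetween c e) X)
    (polyToTwisted hq c) (polyToTwisted_injective hq) (hind _ (by rw [map_zero, smul_zero])
      (fun x y hx hy => by rw [map_add, smul_add, hx, hy]) (fun x n t => by
        rw [polyToTwisted_monomial, hv]
        exact if_pos (Cycle.source_prepend n x.2.2.2).symm)) (by
      have hall : ∀ n : TwistedSpace e q hq, ∃ d, polyToTwisted hq c d = c.vert K • n := by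
        intro n
        induction n using TwistedSpace.induction with
        | zero => exact ⟨0, by rw [map_zero, smul_zero]⟩
        | add x y hx hy =>
          obtain ⟨d, hd⟩ := hx
          obtain ⟨d', hd'⟩ := hy
          exact ⟨d + d', by rw [map_add, hd, hd', smul_add]⟩
        | single x t =>
          rw [hv]
          split_ifs with hx
          · obtain ⟨⟨y, n⟩, rfl⟩ := exists_prependClass_eq h hc hx
            exact ⟨Finsupp.single y (monomial n t), polyToTwisted_monomial hq y n t⟩
          · exact ⟨0, map_zero _⟩
      intro n hn
      obtain ⟨d, hd⟩ := hall n
      exact ⟨d, hd.trans hn⟩) (hind _ (by rw [map_zero, map_zero, smul_zero])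
      (fun x y hx hy => by rw [map_add, map_add, map_add, smul_add, hx, hy]) (fun x n t => by
        -- The twist sits on the first edge of `e`, which is not an edge of `c`, because `c` shares
        -- no vertex with `e`.
        have hw : pathWeight e hq c.edges = 1 := pathWeight_eq_one fun hmem =>
          hc e h _ hmem _ (List.head_mem e.ne_nil) rfl
        rw [mulFamily_single, X_mul_monomial, polyToTwisted_monomial, polyToTwisted_monomial,
          TwistedSpace.elt_smul_single (c := e) c (x := prependClass (x, n + 1))
            (y := prependClass (x, n))
            (Cycle.divides_prepend_succ n x.2.2.2) (Cycle.shift_prepend_succ n x.2.2.2), hw,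
          Units.val_one, one_mul]))
  rwa [aeval_mulFamily] at h1

/-- Over `K' = K[x]/(q)` the polynomial `p` may become reducible, but it stays non-zero of the same
degree, so `K'[x]/(p)` has dimension `deg p` over `K'` and `deg q · deg p` over `K`. -/
theorem rank_ext_of_not_isRotation (hc : c.IsExclusive) (hp : IsBasicIrreducible p)
    (h : ¬ c.IsRotation e) :
    Module.rank K (Abelian.Ext (V c p hp) (V e q hq) 1) =
      Cardinal.lift.{max (u + 1) (v + 1)} (Cardinal.mk (pathsBetween c e)) *
        (p.natDegree : Cardinal) * (q.natDegree : Cardinal) := by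
  have := Fact.mk hq.1
  have hp0 : p.map (algebraMap K (AdjoinRoot q)) ≠ 0 :=
    (Polynomial.map_ne_zero_iff (algebraMap K (AdjoinRoot q)).injective).mpr hp.1.ne_zero
  obtain ⟨f⟩ := nonempty_ext_equiv_of_not_isRotation hq hc hp h
  have h1 := ((mulFamilyQuotEquiv (K := K) (pathsBetween c e) hp0).symm.trans f).lift_rank_eq
  have h2 : Module.rank K (AdjoinRoot (p.map (algebraMap K (AdjoinRoot q)))) =
      q.natDegree * p.natDegree := by
    rw [← rank_mul_rank K (AdjoinRoot q), rank_adjoinRoot hq.1.ne_zero, rank_adjoinRoot hp0,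
      Polynomial.natDegree_map]
  rw [rank_finsupp, h2] at h1
  refine Cardinal.lift_injective.{max u v} (h1.symm.trans ?_)
  simp only [Cardinal.lift_mul, Cardinal.lift_lift, Cardinal.lift_natCast]
  rw [mul_assoc, mul_comm (p.natDegree : Cardinal)]

end Cases

end DirectedGraph

end

/-- The dimension of `Ext¹` (in the category of unital left `L_K(E)`-modules) between the modules
`V^p_{[c^∞]}` and `V^q_{[e^∞]}` for exclusive cycles `c`, `e`. -/
theorem theorem4 (K : Type v) [Field K] (E : DirectedGraph.{u}) (c e : E.Cycle)
    (hc : c.IsExclusive) (he : e.IsExclusive) (p q : K[X])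
    (hp : DirectedGraph.IsBasicIrreducible p) (hq : DirectedGraph.IsBasicIrreducible q) :
    (¬ c.IsRotation e →
      Module.rank K (Abelian.Ext (DirectedGraph.V c p hp) (DirectedGraph.V e q hq) 1) =
        Cardinal.lift.{max (u + 1) (v + 1)} (Cardinal.mk (DirectedGraph.pathsBetween c e)) *
          (p.natDegree : Cardinal) * (q.natDegree : Cardinal)) ∧
    (c.IsRotation e → p ≠ q →
      Module.rank K (Abelian.Ext (DirectedGraph.V c p hp) (DirectedGraph.V e q hq) 1) = 0) ∧
    (c.IsRotation e → p = q →
      Module.rank K (Abelian.Ext (DirectedGraph.V c p hp) (DirectedGraph.V e q hq) 1) =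
        (p.natDegree : Cardinal)) := by
  exact ⟨fun h => DirectedGraph.rank_ext_of_not_isRotation hq hc hp h,
    fun h hne => DirectedGraph.rank_ext_of_isRotation_of_ne hc hp hq h hne,
    fun h heq => DirectedGraph.rank_ext_of_isRotation_of_eq hc hp hq h heq⟩
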